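/- Let $J$ be a finite set. A convex geometry on $J$ is a closure operator $A\mapsto\overline{A}$ on the subsets of $J$ such that, for every closed $A$ and all $x\neq y$ in $J$, $x\in\overline{A\cup\{y\}}$ and $x\notin A$ imply $y\notin\overline{A\cup\{x\}}$. A subset $D\subseteq J$ is dependent if $x\in\overline{D\setminus\{x\}}$ for some $x\in D$; the geometry is a convex $4$-geometry if every inclusion-minimal dependent set has exactly four elements. Its rooted triangles are the pairs $(T,x)$ with $|T|=3$, $x\notin T$ and $x\in\overline{T}$; let $\mathcal{RT}$ be the set of them. The outermost layer is $L_0=\{x\in J: x\notin\overline{J\setminus\{x\}}\}$. Let $J[3]$ be the set of triples of distinct elements of $J$. A function $t:J[3]\to\{1,-1\}$ is associated with the geometry if it is alternating (invariant under cyclic permutations of the three arguments, and changing sign when two arguments are interchanged) and, for all distinct $a,b,c,d\in J$, $$(\{a,b,c\},d)\in\mathcal{RT}\iff t(a,b,c)=t(d,b,c)=t(a,d,c)=t(a,b,d).$$ It supports the clockwise circular order $(a_1,\dots,a_m)$ of $L_0$ if $t(a_i,a_j,a_k)=-1$ whenever $i<j<k$ up to a cyclic shift of $(i,j,k)$. A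 realization of the geometry is an injective map $f:J\to\mathbb{R}^2$ such that no three points of $f(J)$ are collinear and $x\in\overline{A}\iff f(x)\in\operatorname{ch}(f(A))$ for all $A\subseteq J$, $x\in J$, where $\operatorname{ch}$ is the convex hull. Its order type $t_f$ takes the value $1$ at $(a,b,c)$ if $f(a),f(b),f(c)$ are in anticlockwise order, and $-1$ otherwise. The realization has the clockwise order $(a_1,\dots,a_m)$ of $L_0$ if $t_f$ supports this order. Functions $t_1,t_2$ on $J[3]$ are weakly equivalent if there is a permutation $\delta$ of $J$ with $t_2(a,b,c)=t_1(\delta a,\delta b,\delta c)$ for all $(a,b,c)\in J[3]$, or with $-t_2(a,b,c)=t_1(\delta a,\delta b,\delta c)$ for all $(a,b,c)\in J[3]$. Theorem. There is an algorithm (a program for a random access machine with addition and subtraction, counting one step per instruction) whose number of steps is bounded by a polynomial in $|J|$, and which does the following on every input consisting of a finite convex $4$-geometry on $J$ (given by the table of its rooted triangles, for any numbering of $J$) and a circular order $(a_1,\dots,a_m)$ of its outermost layer $L_0$. Either it reports, correctly, that the geometry has no realization with the clockwise order $(a_1,\dots,a_m)$ of $L_0$; or it outputs (as a table) a function $t^*:J[3]\to\{1,-1\}$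 which is the unique function that is associated with the geometry and supports the clockwise circular order $(a_1,\dots,a_m)$. Which of the two happens, and $t^*$, do not depend on the numbering of $J$. In the second case every realization of the geometry with the clockwise order $(a_1,\dots,a_m)$ of $L_0$ has an order type weakly equivalent to $t^*$. In particular, if there is a realization with this clockwise order, then the second case occurs. -/

import Mathlib

universe u

/-! ### Convex geometries and convex 4-geometries -/

namespace ConvexGeom

section Closure

variable {J : Type*} (cl : ClosureOperator (Set J))

/-- The anti-exchange axiom; a closure space that satisfies it is a convex geometry. -/
def AntiExchange : Prop :=
  ∀ A : Set J, cl A = A → ∀ x y : J, x ≠ y →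
    x ∈ cl (A ∪ {y}) → x ∉ A → y ∉ cl (A ∪ {x})

/-- A set is dependent if one of its elements lies in the closure of the others. -/
def Dependent (D : Set J) : Prop := ∃ x ∈ D, x ∈ cl (D \ {x})

/-- A circuit is an inclusion-minimal dependent set. -/
def IsCircuit (C : Set J) : Prop := Minimal (Dependent cl) C

/-- A convex 4-geometry: a convex geometry all of whose circuits have exactly four elements. -/
structure IsConvexFourGeometry : Prop where
  antiExchange : AntiExchange cl
  ncard_circuit : ∀ C : Set J, IsCircuit cl C → C.ncard = 4

/-- The rooted triangles `(T, x)` of the geometry: `T` has three elements and `x` lies in the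
closure of `T` without being one of its elements. -/
def RootedTriangles : Set (Finset J × J) :=
  {p | p.1.card = 3 ∧ p.2 ∉ p.1 ∧ p.2 ∈ cl (p.1 : Set J)}

/-- The outermost layer: the set of extreme points. -/
def outermostLayer : Set J := {x | x ∉ cl (Set.univ \ {x})}

/-- `a` lists the outermost layer without repetition. The list stands for the circular order
`a 0, a 1, …, a (m - 1), a 0, …`. -/
def IsCircularListing {m : ℕ} (a : Fin m → J) : Prop :=
  Function.Injective a ∧ Set.range a = outermostLayer cl

end Closure

/-! ### Orientations of triples and order types -/

/-- `J[3]`: the triples of distinct elements of `J`. -/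
@[ext]
structure Triple (J : Type*) where
  a : J
  b : J
  c : J
  hab : a ≠ b
  hac : a ≠ c
  hbc : b ≠ c

/-- The map `J[3] → J[3]` induced by a bijection of `J`. -/
def Triple.map {J : Type*} (δ : Equiv.Perm J) (s : Triple J) : Triple J :=
  ⟨δ s.a, δ s.b, δ s.c, δ.injective.ne s.hab, δ.injective.ne s.hac, δ.injective.ne s.hbc⟩

/-- The Euclidean plane. -/
abbrev Plane := EuclideanSpace ℝ (Fin 2)

/-- Twice the signed area of the triangle `x y z`. -/
def signedArea (x y z : Plane) : ℝ :=
  (y 0 - x 0) * (z 1 - x 1) - (y 1 - x 1) * (z 0 - x 0)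

open Classical in
/-- The orientation of noncollinear points: `1` if `x, y, z` are in anticlockwise order and `-1`
if they are in clockwise order. It is only used for noncollinear points. -/
noncomputable def orientationSign (x y z : Plane) : ℤˣ :=
  if 0 < signedArea x y z then 1 else -1

/-- The function `t_f` on `J[3]` given by the orientations of the triples of the points `f j`. -/
noncomputable def orderType {J : Type*} (f : J → Plane) (s : Triple J) : ℤˣ :=
  orientationSign (f s.a) (f s.b) (f s.c)

/-- `t₁` and `t₂` agree up to a bijection of `J`. -/
def OrderEquivalent {J : Type*} (t₁ t₂ : Triple J → ℤˣ) : Prop :=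
  ∃ δ : Equiv.Perm J, ∀ s, t₂ s = t₁ (s.map δ)

/-- `t₁` is equivalent to `t₂` or to `-t₂`. -/
def WeaklyEquivalent {J : Type*} (t₁ t₂ : Triple J → ℤˣ) : Prop :=
  OrderEquivalent t₁ t₂ ∨ OrderEquivalent t₁ (fun s => -t₂ s)

/-- `t` supports the clockwise circular order `a 0, a 1, …, a (m - 1)`: it is `-1` on
`(a i, a j, a k)` whenever `i, j, k` are in increasing order up to a cyclic shift. -/
def SupportsClockwise {J : Type*} {m : ℕ} (t : Triple J → ℤˣ) (a : Fin m → J) : Prop :=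
  ∀ i j k : Fin m, (i < j ∧ j < k ∨ j < k ∧ k < i ∨ k < i ∧ i < j) →
    ∀ (hij : a i ≠ a j) (hik : a i ≠ a k) (hjk : a j ≠ a k),
      t ⟨a i, a j, a k, hij, hik, hjk⟩ = -1

/-- `t` behaves like an orientation: invariant under cyclic permutations, and it changes its sign
when two arguments are interchanged. -/
def IsAlternating {J : Type*} (t : Triple J → ℤˣ) : Prop :=
  ∀ s : Triple J,
    t ⟨s.b, s.c, s.a, s.hbc, s.hab.symm, s.hac.symm⟩ = t s ∧
    t ⟨s.a, s.c, s.b, s.hac, s.hab, s.hbc.symm⟩ = -t s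

open Classical in
/-- `t` is associated with the geometry: it is alternating, and its quasi rooted triangles, that
is the `({a, b, c}, d)` with `t(a,b,c) = t(d,b,c) = t(a,d,c) = t(a,b,d)`, are exactly the rooted
triangles of the geometry. -/
def IsAssociated {J : Type*} (cl : ClosureOperator (Set J)) (t : Triple J → ℤˣ) : Prop :=
  IsAlternating t ∧
  ∀ (a b c d : J) (hab : a ≠ b) (hac : a ≠ c) (hbc : b ≠ c)
    (had : a ≠ d) (hbd : b ≠ d) (hcd : c ≠ d),
    (({a, b, c} : Finset J), d) ∈ RootedTriangles cl ↔
      t ⟨a, b, c, hab, hac, hbc⟩ = t ⟨d, b, c, hbd.symm, hcd.symm, hbc⟩ ∧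
      t ⟨a, b, c, hab, hac, hbc⟩ = t ⟨a, d, c, had, hac, hcd.symm⟩ ∧
      t ⟨a, b, c, hab, hac, hbc⟩ = t ⟨a, b, d, hab, had, hbd⟩

/-! ### Realizations -/

/-- `f` realizes the geometry: the points `f j` are distinct, no three of them are collinear, and
`f` carries the closure operator to `Y ↦ ch(Y) ∩ f(J)`. -/
structure IsRealization {J : Type*} (cl : ClosureOperator (Set J)) (f : J → Plane) : Prop where
  injective : Function.Injective f
  generalPosition : ∀ s : Triple J, ¬ Collinear ℝ {f s.a, f s.b, f s.c}
  mem_cl_iff : ∀ (A : Set J) (x : J), x ∈ cl A ↔ f x ∈ convexHull ℝ (f '' A)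

/-- The points `f j` realize the geometry, and the outermost layer, read clockwise, is
`a 0, a 1, …, a (m - 1)`. -/
def IsRealizationWithOrder {J : Type*} (cl : ClosureOperator (Set J)) {m : ℕ} (a : Fin m → J)
    (f : J → Plane) : Prop :=
  IsRealization cl f ∧ SupportsClockwise (orderType f) a

end ConvexGeom

/-! ### A random access machine with a step count -/

namespace RAM

/-- Programs of a random access machine. Registers `r i` and the cells `M A x` of the arrays
`M A` hold natural numbers; a program names finitely many registers and arrays. -/
inductive Program : Type
  | const (i c : ℕ)
  | add (i j k : ℕ)
  | sub (i j k : ℕ)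
  | load (i A j : ℕ)
  | store (A i j : ℕ)
  | seq (P Q : Program)
  | ite (i : ℕ) (P Q : Program)
  | while (i : ℕ) (P : Program)

/-- The contents of the registers and of the arrays. -/
structure State where
  r : ℕ → ℕ
  M : ℕ → ℕ → ℕ

/-- Write `v` into register `i`. -/
def State.setReg (s : State) (i v : ℕ) : State := ⟨Function.update s.r i v, s.M⟩

/-- Write `v` into cell `x` of array `A`. -/
def State.setCell (s : State) (A x v : ℕ) : State :=
  ⟨s.r, Function.update s.M A (Function.update (s.M A) x v)⟩

/-- `Exec P s k s'`: started in state `s`, the program `P` halts after exactly `k` steps in the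
state `s'`. Every instruction and every test of a register costs one step. Subtraction is
truncated; a register passes a test if it is not `0`. -/
inductive Exec : Program → State → ℕ → State → Prop
  | const (i c : ℕ) (s : State) : Exec (.const i c) s 1 (s.setReg i c)
  | add (i j k : ℕ) (s : State) : Exec (.add i j k) s 1 (s.setReg i (s.r j + s.r k))
  | sub (i j k : ℕ) (s : State) : Exec (.sub i j k) s 1 (s.setReg i (s.r j - s.r k))
  | load (i A j : ℕ) (s : State) : Exec (.load i A j) s 1 (s.setReg i (s.M A (s.r j)))
  | store (A i j : ℕ) (s : State) : Exec (.store A i j) s 1 (s.setCell A (s.r i) (s.r j))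
  | seq {P Q : Program} {s s₁ s₂ : State} {k l : ℕ} :
      Exec P s k s₁ → Exec Q s₁ l s₂ → Exec (.seq P Q) s (k + l) s₂
  | ite_true {i : ℕ} {P Q : Program} {s s₁ : State} {k : ℕ} :
      s.r i ≠ 0 → Exec P s k s₁ → Exec (.ite i P Q) s (k + 1) s₁
  | ite_false {i : ℕ} {P Q : Program} {s s₁ : State} {k : ℕ} :
      s.r i = 0 → Exec Q s k s₁ → Exec (.ite i P Q) s (k + 1) s₁
  | while_true {i : ℕ} {P : Program} {s s₁ s₂ : State} {k l : ℕ} :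
      s.r i ≠ 0 → Exec P s k s₁ → Exec (.while i P) s₁ l s₂ →
        Exec (.while i P) s (k + l + 1) s₂
  | while_false {i : ℕ} {P : Program} {s : State} :
      s.r i = 0 → Exec (.while i P) s 1 s

end RAM

/-! ### Input and output of the decision procedure -/

namespace ConvexGeom

open Classical in
/-- The initial state for the geometry `cl` with the circular order `a`, where the `n` elements
of `J` are numbered by `e`. Register `0` holds `n`, register `1` holds the size `m` of the
outermost layer, array `0` lists the numbers of `a 0, …, a (m - 1)`, and array `1` is the 0/1
table of the rooted triangles: the entry of `({x, y, z}, w)` is in the cell whose base-`n` digits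
are the numbers of `x, y, z, w`. All else is `0`. -/
noncomputable def inputState {J : Type*} {n m : ℕ} (cl : ClosureOperator (Set J)) (a : Fin m → J)
    (e : J ≃ Fin n) : RAM.State where
  r i := if i = 0 then n else if i = 1 then m else 0
  M A i :=
    if A = 0 then (if h : i < m then (e (a ⟨i, h⟩) : ℕ) else 0)
    else if A = 1 then
      (if ∃ x y z w : J, i = (((e x : ℕ) * n + e y) * n + e z) * n + e w ∧
          (({x, y, z} : Finset J), w) ∈ RootedTriangles cl then 1 else 0)
    else 0

/-- The final state says that there is no realization with the given order. -/
def Rejects (s : RAM.State) : Prop := s.r 0 = 0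

/-- The final state presents `t`, by a table in array `2` whose cell with the base-`n` digits
`e x, e y, e z` holds `1` if `t(x,y,z) = 1` and `0` if `t(x,y,z) = -1`. -/
def Outputs {J : Type*} {n : ℕ} (e : J ≃ Fin n) (s : RAM.State) (t : Triple J → ℤˣ) : Prop :=
  s.r 0 = 1 ∧
  ∀ q : Triple J, s.M 2 (((e q.a : ℕ) * n + e q.b) * n + e q.c) = if t q = 1 then 1 else 0

end ConvexGeom

/-! An associated `t` is recorded by the relation "`t` is `1` at `(x, y, z)`". The circular order
gives its values on triples of extreme elements; the other values are forced by inference. Besides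
cyclic invariance, `propagate` has two rules: if `z` is surrounded by `x, y, w`, then `(x, y, z)`
has the sign of `(x, y, w)`; and the four signs on a quadruple satisfy a parity condition that
depends only on whether one element is surrounded by the other three, so three signs give the fourth
(`IsOrientation.parity`). Both rules follow from the axioms of an associated function alone, so
everything derived holds for every associated `t` that supports the order
(`IsOrientation.iterate_propagate_le`).

If there is a realization, eleven rounds derive everything (`IsOrientation.known_all`). Two facts
about the plane are needed: an element that is not extreme is surrounded by three extreme ones
(Krein-Milman and Carathéodory, `IsRealization.exists_surrounds`), and any further point can replace
some vertex of a triangle around `d` (`mem_convexHull_exchange`). They settle the triples with one,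
two and three elements that are not extreme, in this order.

The procedure computes the eleventh relation and tests whether it is alternating with the right
rooted triangles. If so, it defines an associated function, and soundness makes it the only one that
supports the order (`eq_ofPositive`); the order type of a realization is then equal to it. If not,
no realization exists, since a realization would make the relation its order type
(`IsRealizationWithOrder.propagate_iff`).

For the running time, every table is defined from earlier ones by a fixed first-order formula with
quantifiers over the numbers below `n`. Such formulas compile to nested loops with a polynomial step
count (`Formula.runs_compile`), and the number of rounds is constant. -/

namespace RAM

/-! ### Step-bounded runs and counting loops. -/

/-- `P`, started in `s`, halts after at most `T` steps in a state that satisfies `Q`. -/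
def Runs (P : Program) (s : State) (T : ℕ) (Q : State → Prop) : Prop :=
  ∃ k s', k ≤ T ∧ Exec P s k s' ∧ Q s'

theorem Runs.mono {P : Program} {s : State} {T T' : ℕ} {Q Q' : State → Prop}
    (h : Runs P s T Q) (hT : T ≤ T') (hQ : ∀ s', Q s' → Q' s') : Runs P s T' Q' := by
  obtain ⟨k, s', hk, he, hq⟩ := h
  exact ⟨k, s', hk.trans hT, he, hQ _ hq⟩

theorem Runs.const {i c : ℕ} {s : State} {Q : State → Prop} (h : Q (s.setReg i c)) :
    Runs (.const i c) s 1 Q := ⟨1, _, le_rfl, .const i c s, h⟩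

theorem Runs.add {i j k : ℕ} {s : State} {Q : State → Prop}
    (h : Q (s.setReg i (s.r j + s.r k))) : Runs (.add i j k) s 1 Q :=
  ⟨1, _, le_rfl, .add i j k s, h⟩

theorem Runs.sub {i j k : ℕ} {s : State} {Q : State → Prop}
    (h : Q (s.setReg i (s.r j - s.r k))) : Runs (.sub i j k) s 1 Q :=
  ⟨1, _, le_rfl, .sub i j k s, h⟩

theorem Runs.load {i A j : ℕ} {s : State} {Q : State → Prop}
    (h : Q (s.setReg i (s.M A (s.r j)))) : Runs (.load i A j) s 1 Q :=
  ⟨1, _, le_rfl, .load i A j s, h⟩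

theorem Runs.store {A i j : ℕ} {s : State} {Q : State → Prop}
    (h : Q (s.setCell A (s.r i) (s.r j))) : Runs (.store A i j) s 1 Q :=
  ⟨1, _, le_rfl, .store A i j s, h⟩

theorem Runs.seq {P P' : Program} {s : State} {T T' : ℕ} {Q Q' : State → Prop}
    (h : Runs P s T Q) (h' : ∀ s', Q s' → Runs P' s' T' Q') :
    Runs (.seq P P') s (T + T') Q' := by
  obtain ⟨k, s', hk, he, hq⟩ := h
  obtain ⟨l, s'', hl, he', hq'⟩ := h' s' hq
  exact ⟨k + l, s'', by omega, .seq he he', hq'⟩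

/-- Sequential composition, where the intermediate condition is that the rest runs. -/
theorem Runs.step {P P' : Program} {s : State} {T T' : ℕ} {Q' : State → Prop}
    (h : Runs P s T fun s' => Runs P' s' T' Q') : Runs (.seq P P') s (T + T') Q' :=
  h.seq fun _ h => h

theorem Runs.ite {i : ℕ} {P P' : Program} {s : State} {T : ℕ} {Q : State → Prop}
    (h : s.r i ≠ 0 → Runs P s T Q) (h' : s.r i = 0 → Runs P' s T Q) :
    Runs (.ite i P P') s (T + 1) Q := by
  by_cases hi : s.r i = 0
  · obtain ⟨k, s', hk, he, hq⟩ := h' hi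
    exact ⟨k + 1, s', by omega, .ite_false hi he, hq⟩
  · obtain ⟨k, s', hk, he, hq⟩ := h hi
    exact ⟨k + 1, s', by omega, .ite_true hi he, hq⟩

/-- Run `P` for the values `r c - 1, …, 0` of register `c`. -/
def countdown (c : ℕ) (P : Program) : Program :=
  .while c (.seq (.const 6 1) (.seq (.sub c c 6) P))

/-- The loop rule, with an invariant indexed by the counter. Each pass costs three steps besides the
body: the test, loading `1` into register `6`, and the decrement. The last failing test adds one. -/
theorem Runs.countdown {c : ℕ} (hc : c ≠ 6) {P : Program} {T : ℕ} (I : ℕ → State → Prop)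
    (h : ∀ k s, s.r c = k + 1 → I (k + 1) s →
      Runs P ((s.setReg 6 1).setReg c k) T fun s' => s'.r c = k ∧ I k s') :
    ∀ (k : ℕ) (s : State), s.r c = k → I k s →
      Runs (RAM.countdown c P) s (k * (T + 3) + 1) fun s' => s'.r c = 0 ∧ I 0 s' := by
  intro k
  induction k with
  | zero => exact fun s hs hI => ⟨1, s, by omega, .while_false hs, hs, hI⟩
  | succ k ih =>
    intro s hs hI
    obtain ⟨l, s', hl, he, hs', hI'⟩ := h k s hs hI
    obtain ⟨l', s'', hl', he', hQ⟩ := ih s' hs' hI'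
    refine ⟨(1 + (1 + l)) + l' + 1, s'', by nlinarith, ?_, hQ⟩
    refine .while_true (by omega) (.seq (.const _ _ _) (.seq (.sub _ _ _ _) ?_)) he'
    convert he using 2
    simp [State.setReg, Function.update_of_ne hc, hs]

/-! ### First-order formulas over tables -/

/-- Bounded first-order formulas about the numbers below `r 0` and the tables in memory.
Variables are named by their binding depth: a quantifier under `d` others binds variable `d`. -/
inductive Formula : Type
  | lt (u v : ℕ)
  | ltSize (v : ℕ)
  | listEq (u v : ℕ)
  | tab (A : ℕ) (l : List ℕ)
  | not (φ : Formula)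
  | and (φ ψ : Formula)
  | ex (φ : Formula)

/-- The number with base-`n` digits `l`, following the digits of `i`. -/
def ofDigitsFrom (n i : ℕ) (l : List ℕ) : ℕ := l.foldl (fun i x => i * n + x) i

namespace Formula

/-- Truth of a formula. -/
def Holds (n m : ℕ) (M : ℕ → ℕ → ℕ) : Formula → ℕ → (ℕ → ℕ) → Prop
  | lt u v, _, x => x u < x v
  | ltSize v, _, x => x v < m
  | listEq u v, _, x => M 0 (x u) = x v
  | tab A l, _, x => M A (ofDigitsFrom n 0 (l.map x)) ≠ 0
  | not φ, d, x => ¬ φ.Holds n m M d x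
  | and φ ψ, d, x => φ.Holds n m M d x ∧ ψ.Holds n m M d x
  | ex φ, d, x => ∃ y < n, φ.Holds n m M (d + 1) (Function.update x d y)

/-- All variables below depth `d` are free or bound. -/
def WellScoped : Formula → ℕ → Prop
  | lt u v, d => u < d ∧ v < d
  | ltSize v, d => v < d
  | listEq u v, d => u < d ∧ v < d
  | tab _ l, d => ∀ v ∈ l, v < d
  | not φ, d => φ.WellScoped d
  | and φ ψ, d => φ.WellScoped d ∧ ψ.WellScoped d
  | ex φ, d => φ.WellScoped (d + 1)

end Formula

/-- The register of variable `v`. -/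
abbrev var (v : ℕ) : ℕ := 10 + 2 * v

/-- `s'` has the memory of `s`, and the registers of `s` outside the scratch space at
depth `d`. -/
def Frame (d : ℕ) (s s' : State) : Prop :=
  s'.M = s.M ∧ ∀ i, i < 2 ∨ 10 ≤ i ∧ i < var d → s'.r i = s.r i

theorem Frame.trans {d : ℕ} {s s' s'' : State} (h : Frame d s s') (h' : Frame d s' s'') :
    Frame d s s'' :=
  ⟨h'.1.trans h.1, fun i hi => (h'.2 i hi).trans (h.2 i hi)⟩

theorem Frame.setReg {d : ℕ} {s s' : State} (h : Frame d s s') {i c : ℕ}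
    (hi : 2 ≤ i ∧ i < 10 ∨ var d ≤ i) : Frame d s (s'.setReg i c) := by
  refine ⟨h.1, fun j hj => ?_⟩
  have : j ≠ i := by unfold var at *; omega
  simp [State.setReg, Function.update_of_ne this, h.2 j hj]

theorem Frame.refl (d : ℕ) (s : State) : Frame d s s := ⟨rfl, fun _ _ => rfl⟩

theorem Frame.anti {d d' : ℕ} {s s' : State} (h : Frame d' s s') (hd : d ≤ d') : Frame d s s' :=
  ⟨h.1, fun i hi => h.2 i (by unfold var at *; omega)⟩

@[simp] theorem State.setReg_r_self (s : State) (i c : ℕ) : (s.setReg i c).r i = c := by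
  simp [State.setReg]

theorem State.setReg_r_of_ne (s : State) {i j : ℕ} (c : ℕ) (h : j ≠ i) :
    (s.setReg i c).r j = s.r j := by
  simp [State.setReg, Function.update_of_ne h]

/-- Replace register `3` by `r 3 * r 0 + r (var v)`. -/
def appendDigit (v : ℕ) : Program :=
  .seq (.const 4 0) (.seq (.const 7 0) (.seq (.add 5 0 7)
    (.seq (countdown 5 (.add 4 4 3)) (.add 3 4 (var v)))))

/-- Multiplication is not an instruction: register `4` accumulates the product by `r 0` additions,
four steps each. -/
theorem runs_appendDigit (d v : ℕ) (s : State) (hv : v < d) :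
    Runs (appendDigit v) s (4 * s.r 0 + 5) fun s' =>
      Frame d s s' ∧ s'.r 3 = s.r 3 * s.r 0 + s.r (var v) := by
  let s₁ := ((s.setReg 4 0).setReg 7 0).setReg 5 (s.r 0)
  have h₁ : Frame d s s₁ := (((Frame.refl d s).setReg (by simp)).setReg (by simp)).setReg (by simp)
  have key := Runs.countdown (c := 5) (by norm_num) (P := .add 4 4 3) (T := 1)
    (fun k s' => Frame d s s' ∧ s'.r 3 = s.r 3 ∧ s'.r 4 + s.r 3 * k = s.r 3 * s.r 0)
    (by
      rintro k s' hk ⟨hf, h3, h4⟩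
      refine Runs.add ⟨?_, ?_, ?_, ?_⟩
      · simp [State.setReg]
      · exact ((hf.setReg (by simp)).setReg (by simp)).setReg (by simp)
      · simp [State.setReg, h3]
      · simp [State.setReg, h3]; linarith)
    (s.r 0) s₁ (by simp [s₁]) ⟨h₁, by simp [s₁, State.setReg], by simp [s₁, State.setReg]⟩
  refine Runs.mono (T := 1 + (1 + (1 + ((s.r 0 * (1 + 3) + 1) + 1)))) ?_ (by omega) (fun _ h => h)
  refine Runs.step (Runs.const ?_)
  refine Runs.step (Runs.const ?_)
  refine Runs.step (Runs.add ?_)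
  have : (((s.setReg 4 0).setReg 7 0).setReg 5
      (((s.setReg 4 0).setReg 7 0).r 0 + ((s.setReg 4 0).setReg 7 0).r 7)) = s₁ := by
    simp [s₁, State.setReg]
  rw [this]
  refine key.seq ?_
  rintro s' ⟨-, hf, -, h4⟩
  refine Runs.add ⟨hf.setReg (by simp), ?_⟩
  have := hf.2 (var v) (by unfold var; omega)
  simp only [State.setReg_r_self, this]
  omega

/-- Append the digits `l` to register `3`. -/
def appendDigits : List ℕ → Program
  | [] => .const 7 0
  | v :: l => .seq (appendDigit v) (appendDigits l)

theorem runs_appendDigits (d : ℕ) (l : List ℕ) : ∀ s : State, (∀ v ∈ l, v < d) →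
    Runs (appendDigits l) s (l.length * (4 * s.r 0 + 5) + 1) fun s' =>
      Frame d s s' ∧ s'.r 3 = ofDigitsFrom (s.r 0) (s.r 3) (l.map fun v => s.r (var v)) := by
  induction l with
  | nil =>
    intro s _
    refine Runs.mono (Runs.const ⟨(Frame.refl d s).setReg (by simp), ?_⟩) (by simp)
      (fun _ h => h)
    simp [ofDigitsFrom, State.setReg]
  | cons v l ih =>
    intro s hl
    refine Runs.mono ((runs_appendDigit d v s (hl v (by simp))).seq (Q' := fun s' => _)
      (T' := l.length * (4 * s.r 0 + 5) + 1) ?_)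
      (by simp only [List.length_cons]; linarith) (fun _ h => h)
    rintro s' ⟨hf, h3⟩
    have h0 := hf.2 0 (by omega)
    have hl' : ∀ v ∈ l, v < d := fun v hv => hl v (by simp [hv])
    refine (ih s' hl').mono (by rw [h0]) ?_
    rintro s'' ⟨hf', h3'⟩
    refine ⟨hf.trans hf', ?_⟩
    rw [h3', h0, h3]
    have : l.map (fun v => s'.r (var v)) = l.map fun v => s.r (var v) :=
      List.map_congr_left fun v hv => hf.2 _ (by have := hl' v hv; unfold var; omega)
    rw [this]
    simp [ofDigitsFrom]

namespace Formula

/-- A program that evaluates a formula at depth `d` and leaves the result in register `2`. -/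
def compile : Formula → ℕ → Program
  | lt u v, _ => .sub 2 (var v) (var u)
  | ltSize v, _ => .sub 2 1 (var v)
  | listEq u v, _ => .seq (.load 3 0 (var u)) (.seq (.sub 4 3 (var v)) (.seq (.sub 5 (var v) 3)
      (.seq (.add 4 4 5) (.ite 4 (.const 2 0) (.const 2 1)))))
  | tab A l, _ => .seq (.const 3 0) (.seq (appendDigits l) (.load 2 A 3))
  | not φ, d => .seq (φ.compile d) (.ite 2 (.const 2 0) (.const 2 1))
  | and φ ψ, d => .seq (φ.compile d) (.ite 2 (ψ.compile d) (.const 2 0))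
  -- Variables occupy every second register. The odd one after `var d` remembers whether a witness
  -- has been found; `.const 7 0` in the other branch does nothing of importance.
  | ex φ, d => .seq (.const 7 0) (.seq (.const (var d + 1) 0) (.seq (.add (var d) 0 7)
      (.seq (countdown (var d)
        (.seq (φ.compile (d + 1)) (.ite 2 (.const (var d + 1) 1) (.const 7 0))))
        (.seq (.const 7 0) (.add 2 (var d + 1) 7)))))

/-- A bound for the number of steps that the evaluation takes, as a polynomial in `r 0`. -/
noncomputable def cost : Formula → Polynomial ℕ
  | lt _ _ => 1
  | ltSize _ => 1
  | listEq _ _ => 6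
  | tab _ l => (l.length : Polynomial ℕ) * (4 * .X + 5) + 3
  | not φ => φ.cost + 2
  | and φ ψ => φ.cost + ψ.cost + 2
  | ex φ => .X * (φ.cost + 5) + 6

/-- Induction on the formula. `Frame d` is what makes it work: evaluation at depth `d` keeps the
variables of the enclosing quantifiers and their witness flags. -/
theorem runs_compile (φ : Formula) : ∀ (d : ℕ) (s : State) (x : ℕ → ℕ),
    (∀ v < d, s.r (var v) = x v) → φ.WellScoped d →
    Runs (φ.compile d) s (φ.cost.eval (s.r 0)) fun s' =>
      Frame d s s' ∧ (s'.r 2 ≠ 0 ↔ φ.Holds (s.r 0) (s.r 1) s.M d x) := by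
  induction φ with
  | lt u v =>
    rintro d s x hx ⟨hu, hv⟩
    refine Runs.mono (Runs.sub ⟨(Frame.refl d s).setReg (by simp), ?_⟩) (by simp [cost])
      (fun _ h => h)
    simp only [State.setReg_r_self, Holds, hx u hu, hx v hv]
    omega
  | ltSize v =>
    rintro d s x hx hv
    refine Runs.mono (Runs.sub ⟨(Frame.refl d s).setReg (by simp), ?_⟩) (by simp [cost])
      (fun _ h => h)
    simp only [State.setReg_r_self, Holds, hx v hv]
    omega
  | listEq u v =>
    rintro d s x hx ⟨hu, hv⟩
    have e1 := hx u hu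
    have e2 := hx v hv
    have n3 : 10 + 2 * v ≠ 3 := by omega
    have n4 : 10 + 2 * v ≠ 4 := by omega
    refine Runs.mono (T := 1 + (1 + (1 + (1 + (1 + 1))))) ?_ (by simp [cost]) (fun _ h => h)
    refine Runs.step (Runs.load (Runs.step (Runs.sub (Runs.step (Runs.sub (Runs.step
      (Runs.add (Runs.ite (fun h => Runs.const ⟨?_, ?_⟩) fun h => Runs.const ⟨?_, ?_⟩))))))))
    · exact (((((Frame.refl d s).setReg (by simp)).setReg (by simp)).setReg (by simp)).setReg
        (by simp)).setReg (by simp)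
    · simp [State.setReg, Holds, e1, e2, var, n3, n4] at h ⊢
      omega
    · exact (((((Frame.refl d s).setReg (by simp)).setReg (by simp)).setReg (by simp)).setReg
        (by simp)).setReg (by simp)
    · simp [State.setReg, Holds, e1, e2, var, n3, n4] at h ⊢
      omega
  | tab A l =>
    rintro d s x hx hl
    refine Runs.mono (T := 1 + ((l.length * (4 * s.r 0 + 5) + 1) + 1)) ?_
      (by simp [cost]; omega) (fun _ h => h)
    refine Runs.step (Runs.const ?_)
    refine (runs_appendDigits d l (s.setReg 3 0) hl).seq ?_
    rintro s' ⟨hf, h3⟩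
    have hf' := ((Frame.refl d s).setReg (i := 3) (c := 0) (by simp)).trans hf
    refine Runs.load ⟨hf'.setReg (by simp), ?_⟩
    have : l.map (fun v => (s.setReg 3 0).r (var v)) = l.map x :=
      List.map_congr_left fun v hv => by
        rw [State.setReg_r_of_ne _ _ (by unfold var; omega), hx v (hl v hv)]
    rw [this] at h3
    simp only [State.setReg_r_self, Holds, h3, hf'.1]
    rw [State.setReg_r_of_ne _ _ (by norm_num)]
  | not φ ih =>
    intro d s x hx hφ
    refine Runs.mono (T := φ.cost.eval (s.r 0) + (1 + 1)) ?_ (by simp [cost]) (fun _ h => h)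
    refine (ih d s x hx hφ).seq ?_
    rintro s' ⟨hf, h⟩
    refine Runs.ite (fun h2 => Runs.const ⟨hf.setReg (by simp), ?_⟩)
      (fun h2 => Runs.const ⟨hf.setReg (by simp), ?_⟩)
    · simpa [Holds] using h.1 h2
    · simpa [Holds] using fun h' => h.2 h' h2
  | and φ ψ ih ih' =>
    rintro d s x hx ⟨hφ, hψ⟩
    refine Runs.mono (T := φ.cost.eval (s.r 0) + (ψ.cost.eval (s.r 0) + 1 + 1)) ?_
      (by simp [cost]; omega) (fun _ h => h)
    refine (ih d s x hx hφ).seq ?_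
    rintro s' ⟨hf, h⟩
    refine Runs.ite (fun h2 => ?_)
      (fun h2 => (Runs.const ⟨hf.setReg (by simp), ?_⟩).mono (by omega) (fun _ h => h))
    · refine (ih' d s' x (fun v hv => ?_) hψ).mono ?_ ?_
      · rw [hf.2 _ (by unfold var; omega), hx v hv]
      · rw [hf.2 0 (by omega)]; omega
      · rintro s'' ⟨hf', h'⟩
        refine ⟨hf.trans hf', ?_⟩
        rw [h', hf.2 0 (by omega), hf.2 1 (by omega), hf.1]
        exact ⟨fun h'' => ⟨h.1 h2, h''⟩, fun h'' => h''.2⟩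
    · simpa [Holds] using fun h' => absurd h2 (h.2 h')
  | ex φ ih =>
    intro d s x hx hφ
    let s₁ := ((s.setReg 7 0).setReg (var d + 1) 0).setReg (var d) (s.r 0)
    have h₁ : Frame d s s₁ :=
      (((Frame.refl d s).setReg (by simp)).setReg (by simp)).setReg (by simp)
    let φ' : ℕ → Prop := fun y =>
      φ.Holds (s.r 0) (s.r 1) s.M (d + 1) (Function.update x d y)
    have key := Runs.countdown (c := var d) (by unfold var; omega)
      (P := .seq (φ.compile (d + 1)) (.ite 2 (.const (var d + 1) 1) (.const 7 0)))
      (T := φ.cost.eval (s.r 0) + (1 + 1))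
      (fun k s' => Frame d s s' ∧ (s'.r (var d + 1) ≠ 0 ↔ ∃ y, k ≤ y ∧ y < s.r 0 ∧ φ' y)
        ∧ k ≤ s.r 0)
      (by
        rintro k s' hk ⟨hf, hacc, hkn⟩
        have hf1 : Frame d s ((s'.setReg 6 1).setReg (var d) k) :=
          (hf.setReg (by simp)).setReg (by simp)
        have hr := ih (d + 1) ((s'.setReg 6 1).setReg (var d) k) (Function.update x d k) (by
          intro v hv
          rcases Nat.lt_succ_iff_lt_or_eq.1 hv with hv | rfl
          · rw [hf1.2 _ (by unfold var; omega), hx v hv, Function.update_of_ne hv.ne]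
          · simp) hφ
        rw [hf1.2 0 (by omega), hf1.2 1 (by omega), hf1.1] at hr
        refine hr.seq ?_
        rintro s'' ⟨hf', h⟩
        have hf2 : Frame d s s'' := hf1.trans (hf'.anti (by omega))
        have hc : s''.r (var d) = k := by rw [hf'.2 _ (by unfold var; omega)]; simp
        have ha : s''.r (var d + 1) = s'.r (var d + 1) := by
          rw [hf'.2 _ (by unfold var; omega), State.setReg_r_of_ne _ _ (by omega),
            State.setReg_r_of_ne _ _ (by unfold var; omega)]
        refine Runs.ite (fun h2 => Runs.const ⟨?_, hf2.setReg (by simp), ?_, by omega⟩)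
          (fun h2 => Runs.const ⟨?_, hf2.setReg (by simp), ?_, by omega⟩)
        · rw [State.setReg_r_of_ne _ _ (by omega), hc]
        · simp only [State.setReg_r_self]
          exact ⟨fun _ => ⟨k, le_rfl, by omega, h.1 h2⟩, fun _ => one_ne_zero⟩
        · rw [State.setReg_r_of_ne _ _ (by unfold var; omega), hc]
        · rw [State.setReg_r_of_ne _ _ (by unfold var; omega), ha, hacc]
          constructor
          · rintro ⟨y, hy, hy'⟩
            exact ⟨y, by omega, hy'⟩
          · rintro ⟨y, hy, hy', hy''⟩
            rcases hy.eq_or_lt with rfl | hy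
            · exact absurd h2 (h.2 hy'')
            · exact ⟨y, hy, hy', hy''⟩)
      (s.r 0) s₁ (by simp [s₁]) ⟨h₁, by
        rw [State.setReg_r_of_ne _ _ (by omega), State.setReg_r_self]
        constructor
        · simp
        · rintro ⟨y, hy⟩; omega, le_rfl⟩
    refine Runs.mono (T := 1 + (1 + (1 + ((s.r 0 * (φ.cost.eval (s.r 0) + (1 + 1) + 3) + 1)
      + (1 + 1))))) ?_ (by simp [cost, add_assoc]; omega) (fun _ h => h)
    refine Runs.step (Runs.const (Runs.step (Runs.const (Runs.step (Runs.add ?_)))))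
    have : ((s.setReg 7 0).setReg (var d + 1) 0).setReg (var d)
        (((s.setReg 7 0).setReg (var d + 1) 0).r 0 + ((s.setReg 7 0).setReg (var d + 1) 0).r 7)
        = s₁ := by
      have h0 : ((s.setReg 7 0).setReg (var d + 1) 0).r 0 = s.r 0 := by
        rw [State.setReg_r_of_ne _ _ (by omega), State.setReg_r_of_ne _ _ (by omega)]
      have h7 : ((s.setReg 7 0).setReg (var d + 1) 0).r 7 = 0 := by
        rw [State.setReg_r_of_ne _ _ (by unfold var; omega), State.setReg_r_self]
      rw [h0, h7]; rfl
    rw [this]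
    refine key.seq ?_
    rintro s' ⟨-, hf, h, -⟩
    refine Runs.step (Runs.const (Runs.add ⟨(hf.setReg (by simp)).setReg (by simp), ?_⟩))
    rw [State.setReg_r_self, State.setReg_r_of_ne _ _ (by unfold var; omega),
      State.setReg_r_self, add_zero, h]
    simp [Holds, φ']

end Formula

/-! ### Filling a table -/

/-- Run `P` for all values of variable `d` below `r 0`. -/
def forVar (d : ℕ) (P : Program) : Program :=
  .seq (.const 7 0) (.seq (.add (var d) 0 7) (countdown (var d) P))

/-- A form that can be nested: `good t` is a fact about the memory that the body never destroys, and
the pass for `y` establishes the facts in `new y`. The conclusion has the shape required of the body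
of an outer loop. -/
theorem Runs.forVar {d n T : ℕ} {P : Program} {ι : Type*} (G : State → Prop)
    (good : ι → (ℕ → ℕ → ℕ) → Prop) (new : ℕ → Set ι) (hn : ∀ s, G s → s.r 0 = n)
    (hG : ∀ s i c, i = 6 ∨ i = 7 ∨ i = var d → G s → G (s.setReg i c))
    (h : ∀ y < n, ∀ s, s.r (var d) = y → G s → Runs P s T fun s' =>
      (s'.r (var d) = y ∧ G s') ∧ ∀ t, good t s.M ∨ t ∈ new y → good t s'.M)
    (s : State) (hs : G s) :
    Runs (RAM.forVar d P) s (n * (T + 3) + 3) fun s' =>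
      G s' ∧ ∀ t, good t s.M ∨ (∃ y < n, t ∈ new y) → good t s'.M := by
  let s₁ := (s.setReg 7 0).setReg (var d) n
  have key := Runs.countdown (c := var d) (by unfold var; omega) (P := P) (T := T)
    (fun k s' => G s' ∧ k ≤ n ∧
      ∀ t, good t s.M ∨ (∃ y, k ≤ y ∧ y < n ∧ t ∈ new y) → good t s'.M)
    (by
      rintro k s' - ⟨hg, hk, ht⟩
      refine (h k (by omega) ((s'.setReg 6 1).setReg (var d) k) (by simp)
        (hG _ _ _ (by simp) (hG _ _ _ (by simp) hg))).mono le_rfl ?_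
      rintro s'' ⟨⟨h1, h2⟩, h3⟩
      refine ⟨h1, h2, by omega, fun t htt => h3 t ?_⟩
      rcases htt with htt | ⟨y, hy, hy'⟩
      · exact .inl (ht t (.inl htt))
      · rcases hy.eq_or_lt with rfl | hy
        · exact .inr hy'.2
        · exact .inl (ht t (.inr ⟨y, hy, hy'⟩)))
    n s₁ (by simp [s₁]) ⟨hG _ _ _ (by simp) (hG _ _ _ (by simp) hs), le_rfl, by
      rintro t (ht | ⟨y, hy, hy', -⟩)
      · exact ht
      · omega⟩
  refine Runs.mono (T := 1 + (1 + (n * (T + 3) + 1))) ?_ (by omega) (fun _ h => h)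
  refine Runs.step (Runs.const (Runs.step (Runs.add ?_)))
  have : (s.setReg 7 0).r 0 + (s.setReg 7 0).r 7 = n := by
    rw [State.setReg_r_of_ne _ _ (by omega), State.setReg_r_self, hn s hs, add_zero]
  rw [this]
  refine key.mono le_rfl ?_
  rintro s' ⟨-, hg, -, ht⟩
  refine ⟨hg, fun t htt => ht t ?_⟩
  rcases htt with htt | ⟨y, hy⟩
  · exact .inl htt
  · exact .inr ⟨y, by omega, hy⟩

/-- Write into array `B` the table of the ternary relation defined by `φ`. -/
def fill (B : ℕ) (φ : Formula) : Program :=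
  forVar 0 (forVar 1 (forVar 2 (.seq (φ.compile 3) (.seq (.ite 2 (.const 11 1) (.const 11 0))
    (.seq (.const 3 0) (.seq (appendDigits [0, 1, 2]) (.store B 3 11)))))))

/-- A bound for the number of steps of `fill`. -/
noncomputable def fillCost (φ : Formula) : Polynomial ℕ :=
  .X * (.X * (.X * (φ.cost + (3 * (4 * .X + 5) + 5) + 3) + 3 + 3) + 3 + 3) + 3

/-- The assignment of `x, y, z` to the first three variables. -/
def assign (x y z : ℕ) (v : ℕ) : ℕ := if v = 0 then x else if v = 1 then y else z

theorem mul_add_inj {n x y x' y' : ℕ} (hy : y < n) (hy' : y' < n)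
    (h : x * n + y = x' * n + y') : x = x' ∧ y = y' := by
  have h1 := congrArg (· / n) h
  have h2 := congrArg (· % n) h
  have hn : 0 < n := by omega
  simp only [mul_comm _ n, Nat.mul_add_div hn, Nat.div_eq_of_lt hy, Nat.div_eq_of_lt hy',
    Nat.mul_add_mod, Nat.mod_eq_of_lt hy, Nat.mod_eq_of_lt hy'] at h1 h2
  exact ⟨by simpa using h1, h2⟩

-- The formula is evaluated while array `B` is partly overwritten. Hence its meaning is required for
-- every memory that agrees with `M₀` outside `B`.
open Classical in
theorem runs_fill {B : ℕ} {φ : Formula} (hφ : φ.WellScoped 3) {n m : ℕ} {M₀ : ℕ → ℕ → ℕ}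
    {ψ : ℕ → ℕ → ℕ → Prop}
    (h : ∀ M : ℕ → ℕ → ℕ, (∀ A, A ≠ B → M A = M₀ A) → ∀ x < n, ∀ y < n, ∀ z < n,
      (φ.Holds n m M 3 (assign x y z) ↔ ψ x y z))
    {s : State} (h0 : s.r 0 = n) (h1 : s.r 1 = m) (hM : ∀ A, A ≠ B → s.M A = M₀ A) :
    Runs (fill B φ) s ((fillCost φ).eval n) fun s' =>
      s'.r 0 = n ∧ s'.r 1 = m ∧ (∀ A, A ≠ B → s'.M A = M₀ A) ∧
      ∀ x < n, ∀ y < n, ∀ z < n, s'.M B ((x * n + y) * n + z) = if ψ x y z then 1 else 0 := by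
  let G : State → Prop := fun s => s.r 0 = n ∧ s.r 1 = m ∧ ∀ A, A ≠ B → s.M A = M₀ A
  let good : ℕ × ℕ × ℕ → (ℕ → ℕ → ℕ) → Prop := fun t M =>
    t.1 < n → t.2.1 < n → t.2.2 < n →
      M B ((t.1 * n + t.2.1) * n + t.2.2) = if ψ t.1 t.2.1 t.2.2 then 1 else 0
  have hset : ∀ (s : State) (i c : ℕ), 2 ≤ i → G s → G (s.setReg i c) := by
    rintro s i c hi ⟨g0, g1, g2⟩
    refine ⟨?_, ?_, g2⟩
    · rw [State.setReg_r_of_ne _ _ (by omega), g0]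
    · rw [State.setReg_r_of_ne _ _ (by omega), g1]
  have body : ∀ x < n, ∀ y < n, ∀ z < n, ∀ s : State, G s → s.r (var 0) = x → s.r (var 1) = y →
      s.r (var 2) = z →
      Runs (.seq (φ.compile 3) (.seq (.ite 2 (.const 11 1) (.const 11 0))
        (.seq (.const 3 0) (.seq (appendDigits [0, 1, 2]) (.store B 3 11))))) s
        (φ.cost.eval n + (3 * (4 * n + 5) + 5)) fun s' =>
        (s'.r (var 2) = z ∧ (G s' ∧ s'.r (var 0) = x) ∧ s'.r (var 1) = y) ∧
          ∀ t, good t s.M ∨ t ∈ ({(x, y, z)} : Set (ℕ × ℕ × ℕ)) → good t s'.M := by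
    rintro x hx y hy z hz s ⟨g0, g1, g2⟩ rx ry rz
    have hr := Formula.runs_compile φ 3 s (assign x y z) (by
      intro v hv
      interval_cases v
      · simpa [assign] using rx
      · simpa [assign] using ry
      · simpa [assign] using rz) hφ
    rw [g0, g1] at hr
    refine Runs.mono (T := φ.cost.eval n + ((1 + 1) + (1 + ((3 * (4 * n + 5) + 1) + 1)))) ?_
      (by omega) (fun _ h => h)
    refine hr.seq ?_
    rintro s₁ ⟨hf, h2⟩
    rw [h s.M g2 x hx y hy z hz] at h2
    -- Register `11` can hold the bit: it is the flag register of variable `0`, which is bound by a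
    -- loop and not by a quantifier, and `appendDigits` keeps it.
    have hbit : Runs (.ite 2 (.const 11 1) (.const 11 0)) s₁ (1 + 1) fun s₂ =>
        s₂ = s₁.setReg 11 (if ψ x y z then 1 else 0) := by
      refine Runs.ite (fun h' => Runs.const ?_) (fun h' => Runs.const ?_)
      · rw [if_pos (h2.1 h')]
      · rw [if_neg fun h'' => h2.2 h'' h']
    refine hbit.seq ?_
    rintro s₂ rfl
    refine Runs.step (Runs.const ?_)
    set s₃ := (s₁.setReg 11 (if ψ x y z then 1 else 0)).setReg 3 0 with hs₃
    have r3 : ∀ i, i = 0 ∨ i = 1 ∨ i = 10 ∨ i = 12 ∨ i = 14 → s₃.r i = s.r i := by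
      intro i hi
      rw [hs₃, State.setReg_r_of_ne _ _ (by omega), State.setReg_r_of_ne _ _ (by omega),
        hf.2 i (by simp only [var]; omega)]
    have r11 : s₃.r 11 = if ψ x y z then 1 else 0 := by
      rw [hs₃, State.setReg_r_of_ne _ _ (by omega), State.setReg_r_self]
    have hd := runs_appendDigits 3 [0, 1, 2] s₃ (by simp)
    rw [r3 0 (by simp), g0] at hd
    refine hd.seq ?_
    rintro s₄ ⟨hf', hi⟩
    have r4 : ∀ i, i = 0 ∨ i = 1 ∨ i = 10 ∨ i = 12 ∨ i = 14 → s₄.r i = s.r i := fun i hi => by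
      rw [hf'.2 i (by simp only [var]; omega), r3 i hi]
    have hidx : s₄.r 3 = (x * n + y) * n + z := by
      have e3 : s₃.r 3 = 0 := by rw [hs₃, State.setReg_r_self]
      rw [hi, e3]
      simp only [ofDigitsFrom, List.map_cons, List.map_nil, List.foldl_cons, List.foldl_nil, var]
      rw [r3 _ (by simp), r3 _ (by simp), r3 _ (by simp)]
      simp only [var] at rx ry rz
      simp at rx ry rz ⊢
      rw [rx, ry, rz]
    have h11 : s₄.r 11 = if ψ x y z then 1 else 0 := by
      rw [hf'.2 11 (by simp [var]), r11]
    have hMs : s₄.M = s.M := by rw [hf'.1, hs₃]; exact hf.1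
    refine Runs.store ⟨⟨?_, ⟨⟨?_, ?_, ?_⟩, ?_⟩, ?_⟩, ?_⟩
    · exact (r4 14 (by simp)).trans rz
    · exact (r4 0 (by simp)).trans g0
    · exact (r4 1 (by simp)).trans g1
    · intro A hA
      simp [State.setCell, Function.update_of_ne hA, hMs, g2 A hA]
    · exact (r4 10 (by simp)).trans rx
    · exact (r4 12 (by simp)).trans ry
    · rintro ⟨x', y', z'⟩ ht hx' hy' hz'
      simp only [State.setCell, Function.update_self, hidx, h11, hMs]
      rcases eq_or_ne ((x' * n + y') * n + z') ((x * n + y) * n + z) with he | he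
      · obtain ⟨he', rfl⟩ := mul_add_inj hz' hz he
        obtain ⟨rfl, rfl⟩ := mul_add_inj hy' hy he'
        simp
      · rw [Function.update_of_ne he]
        rcases ht with ht | ht
        · exact ht hx' hy' hz'
        · obtain ⟨rfl, rfl, rfl⟩ : x' = x ∧ y' = y ∧ z' = z := by simpa using ht
          exact absurd rfl he
  have inner : ∀ x < n, ∀ y < n, ∀ s : State, (G s ∧ s.r (var 0) = x) ∧ s.r (var 1) = y →
      Runs _ s _ _ := fun x hx y hy =>
    Runs.forVar (d := 2) (n := n) (fun s => (G s ∧ s.r (var 0) = x) ∧ s.r (var 1) = y) good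
      (fun z => {(x, y, z)}) (fun s hs => hs.1.1.1)
      (by
        rintro s i c hi ⟨⟨hg, hx⟩, hy⟩
        simp only [var] at hi hx hy ⊢
        refine ⟨⟨hset s i c (by omega) hg, ?_⟩, ?_⟩
        · rw [State.setReg_r_of_ne _ _ (by omega), hx]
        · rw [State.setReg_r_of_ne _ _ (by omega), hy])
      (fun z hz s rz hs => body x hx y hy z hz s hs.1.1 hs.1.2 hs.2 rz)
  have middle : ∀ x < n, ∀ s : State, G s ∧ s.r (var 0) = x → Runs _ s _ _ := fun x hx =>
    Runs.forVar (d := 1) (n := n) (fun s => G s ∧ s.r (var 0) = x) good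
      (fun y => {t | ∃ z < n, t ∈ ({(x, y, z)} : Set (ℕ × ℕ × ℕ))}) (fun s hs => hs.1.1)
      (by
        rintro s i c hi ⟨hg, hx⟩
        simp only [var] at hi hx ⊢
        refine ⟨hset s i c (by omega) hg, ?_⟩
        rw [State.setReg_r_of_ne _ _ (by omega), hx])
      (fun y hy s ry hs => (inner x hx y hy s ⟨hs, ry⟩).mono le_rfl
        fun s' hs' => ⟨⟨hs'.1.2, hs'.1.1⟩, hs'.2⟩)
  have outer : ∀ s : State, G s → Runs _ s _ _ :=
    Runs.forVar (d := 0) (n := n) G good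
      (fun x => {t | ∃ y < n, ∃ z < n, t ∈ ({(x, y, z)} : Set (ℕ × ℕ × ℕ))}) (fun s hs => hs.1)
      (by
        rintro s i c hi hg
        simp only [var] at hi
        exact hset s i c (by omega) hg)
      (fun x hx s rx hs => (middle x hx s ⟨hs, rx⟩).mono le_rfl
        fun s' hs' => ⟨⟨hs'.1.2, hs'.1.1⟩, hs'.2⟩)
  refine (outer s ⟨h0, h1, hM⟩).mono (by simp [fillCost]) ?_
  rintro s' ⟨⟨g0, g1, g2⟩, h'⟩
  exact ⟨g0, g1, g2, fun x hx y hy z hz =>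
    h' (x, y, z) (.inr ⟨x, hx, y, hy, z, hz, rfl⟩) hx hy hz⟩

end RAM

namespace ConvexGeom

/-! ### Orientations in the plane -/

theorem mem_convexHull_triple {a b c d : Plane} :
    d ∈ convexHull ℝ {a, b, c} ↔ ∃ α β γ : ℝ, 0 ≤ α ∧ 0 ≤ β ∧ 0 ≤ γ ∧ α + β + γ = 1 ∧
      d = α • a + β • b + γ • c := by
  constructor
  · intro h
    rw [convexHull_insert (Set.insert_nonempty _ _), convexHull_pair, mem_convexJoin] at h
    obtain ⟨p, rfl, q, ⟨s, t, hs, ht, hst, rfl⟩, u, v, hu, hv, huv, rfl⟩ := h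
    refine ⟨u, v * s, v * t, hu, by positivity, by positivity, ?_, ?_⟩
    · rw [add_assoc, ← mul_add, hst, mul_one, huv]
    · rw [smul_add, smul_smul, smul_smul, add_assoc]
  · rintro ⟨α, β, γ, hα, hβ, hγ, h, rfl⟩
    have := (convex_convexHull ℝ ({a, b, c} : Set Plane)).sum_mem (t := Finset.univ)
      (w := ![α, β, γ]) (z := ![a, b, c]) (by intro i _; fin_cases i <;> simpa)
      (by simp [Fin.sum_univ_three, h])
      (by intro i _; fin_cases i <;> exact subset_convexHull ℝ _ (by simp))
    simpa [Fin.sum_univ_three] using this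

theorem signedArea_cycle (x y z : Plane) : signedArea y z x = signedArea x y z := by
  unfold signedArea; ring

theorem signedArea_swap (x y z : Plane) : signedArea x z y = -signedArea x y z := by
  unfold signedArea; ring

/-- Divided by the right-hand side, the three summands are the barycentric coordinates of `d`. -/
theorem signedArea_add (a b c d : Plane) :
    signedArea d b c + signedArea a d c + signedArea a b d = signedArea a b c := by
  unfold signedArea; ring

theorem collinear_of_signedArea_eq_zero {x y z : Plane} (h : signedArea x y z = 0) :
    Collinear ℝ {x, y, z} := by
  by_cases hxy : y = x
  · subst hxy
    simpa using collinear_pair ℝ y z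
  rw [collinear_iff_of_mem (p₀ := x) (by simp)]
  refine ⟨y - x, ?_⟩
  have hv : (y 0 - x 0) ^ 2 + (y 1 - x 1) ^ 2 ≠ 0 := by
    intro h0
    apply hxy
    ext i
    fin_cases i <;> simp <;> nlinarith [sq_nonneg (y 0 - x 0), sq_nonneg (y 1 - x 1)]
  rintro p (rfl | rfl | rfl)
  · exact ⟨0, by simp⟩
  · exact ⟨1, by simp⟩
  -- The coefficient of the orthogonal projection of `p - x` to `y - x`.
  · refine ⟨((y 0 - x 0) * (p 0 - x 0) + (y 1 - x 1) * (p 1 - x 1)) /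
      ((y 0 - x 0) ^ 2 + (y 1 - x 1) ^ 2), ?_⟩
    unfold signedArea at h
    ext i
    fin_cases i <;> simp <;> field_simp
    · linear_combination (-(y 1 - x 1)) * h
    · linear_combination (y 0 - x 0) * h

/-- The barycentric coordinates of `d` are quotients of signed areas. The factor `ε`, used as `1`
and `-1`, covers both orientations of the triangle. -/
theorem mem_convexHull_of_signedArea {a b c d : Plane} {ε : ℝ} (ha : 0 < ε * signedArea d b c)
    (hb : 0 < ε * signedArea a d c) (hc : 0 < ε * signedArea a b d) :
    d ∈ convexHull ℝ {a, b, c} := by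
  have hS : 0 < ε * signedArea a b c := by rw [← signedArea_add a b c d]; linarith
  have hε : ε ≠ 0 := left_ne_zero_of_mul hS.ne'
  have hS' : signedArea a b c ≠ 0 := right_ne_zero_of_mul hS.ne'
  have quot : ∀ t, 0 < ε * t → 0 ≤ t / signedArea a b c := fun t ht => by
    rw [← mul_div_mul_left _ _ hε]; positivity
  refine mem_convexHull_triple.2 ⟨_, _, _, quot _ ha, quot _ hb, quot _ hc, ?_, ?_⟩
  · rw [← add_div, ← add_div, signedArea_add, div_self hS']
  · ext i
    fin_cases i <;> simp <;> field_simp <;> unfold signedArea <;> ring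

theorem signedArea_of_mem_convexHull {a b c d : Plane} (h : d ∈ convexHull ℝ {a, b, c}) :
    ∃ α β γ : ℝ, 0 ≤ α ∧ 0 ≤ β ∧ 0 ≤ γ ∧ signedArea d b c = α * signedArea a b c ∧
      signedArea a d c = β * signedArea a b c ∧ signedArea a b d = γ * signedArea a b c := by
  obtain ⟨α, β, γ, hα, hβ, hγ, h, rfl⟩ := mem_convexHull_triple.1 h
  obtain rfl : α = 1 - β - γ := by linarith
  refine ⟨_, β, γ, hα, hβ, hγ, ?_, ?_, ?_⟩ <;> simp [signedArea] <;> ring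

theorem mem_convexHull_iff_pos {a b c d : Plane}
    (ha : signedArea d b c ≠ 0) (hb : signedArea a d c ≠ 0) (hc : signedArea a b d ≠ 0) :
    d ∈ convexHull ℝ {a, b, c} ↔
      (0 < signedArea a b c ↔ 0 < signedArea d b c) ∧
      (0 < signedArea a b c ↔ 0 < signedArea a d c) ∧
      (0 < signedArea a b c ↔ 0 < signedArea a b d) := by
  constructor
  · intro hd
    obtain ⟨α, β, γ, hα, hβ, hγ, eα, eβ, eγ⟩ := signedArea_of_mem_convexHull hd
    have key : ∀ t r : ℝ, 0 ≤ r → t ≠ 0 → t = r * signedArea a b c →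
        (0 < signedArea a b c ↔ 0 < t) := by
      rintro t r hr ht rfl
      have : 0 < r := hr.lt_of_ne' (left_ne_zero_of_mul ht)
      exact (mul_pos_iff_of_pos_left this).symm
    exact ⟨key _ _ hα ha eα, key _ _ hβ hb eβ, key _ _ hγ hc eγ⟩
  · rintro ⟨h1, h2, h3⟩
    by_cases hp : 0 < signedArea a b c
    · exact mem_convexHull_of_signedArea (ε := 1) (by simpa using h1.1 hp)
        (by simpa using h2.1 hp) (by simpa using h3.1 hp)
    · have neg : ∀ t : ℝ, t ≠ 0 → (0 < signedArea a b c ↔ 0 < t) → 0 < -1 * t := fun t ht h => by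
        have := lt_of_le_of_ne (not_lt.1 fun h' => hp (h.2 h')) ht
        linarith
      exact mem_convexHull_of_signedArea (neg _ ha h1) (neg _ hb h2) (neg _ hc h3)

/-- A point `e` can replace one of the vertices of a triangle around `d`. -/
theorem mem_convexHull_exchange {x y z d e : Plane} (h : signedArea x y z ≠ 0)
    (hx : signedArea d y z ≠ 0) (hy : signedArea x d z ≠ 0) (hz : signedArea x y d ≠ 0)
    (hex : signedArea e d x ≠ 0) (hey : signedArea e d y ≠ 0) (hez : signedArea e d z ≠ 0)
    (hd : d ∈ convexHull ℝ {x, y, z}) :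
    d ∈ convexHull ℝ {e, x, y} ∨ d ∈ convexHull ℝ {e, y, z} ∨ d ∈ convexHull ℝ {e, x, z} := by
  wlog hpos : 0 < signedArea x y z generalizing y z
  · have := this (y := z) (z := y) (by rwa [signedArea_swap, neg_ne_zero])
      (by rwa [signedArea_swap, neg_ne_zero]) (by rwa [signedArea_swap, neg_ne_zero])
      (by rwa [signedArea_swap, neg_ne_zero]) hez hey (by rwa [Set.pair_comm])
      (by rw [signedArea_swap]; have := lt_of_le_of_ne (not_lt.1 hpos) h; linarith)
    rw [Set.pair_comm z y] at this
    tauto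
  obtain ⟨h1, h2, h3⟩ := (mem_convexHull_iff_pos hx hy hz).1 hd
  have p1 := h1.1 hpos
  have p2 := h2.1 hpos
  have p3 := h3.1 hpos
  -- The barycentric relation for `d`, paired with the direction `d - e`. Its coefficients are
  -- positive, so `x, y, z` do not all lie on one side of the line `e d`.
  have key : signedArea d y z * signedArea e d x + signedArea x d z * signedArea e d y +
      signedArea x y d * signedArea e d z = 0 := by unfold signedArea; ring
  have mem : ∀ u v : Plane, 0 < signedArea u v d → signedArea e d u < 0 → 0 < signedArea e d v →
      d ∈ convexHull ℝ {e, u, v} := by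
    intro u v h1 h2 h3
    refine mem_convexHull_of_signedArea (ε := 1) ?_ ?_ ?_ <;> rw [one_mul]
    · rw [← signedArea_cycle]; exact h1
    · exact h3
    · rw [signedArea_swap]; linarith
  have p1' : 0 < signedArea y z d := by rwa [signedArea_cycle]
  have p2' : 0 < signedArea z x d := by rwa [← signedArea_cycle]
  -- A nonconstant cyclic sequence of signs has a step from minus to plus; that edge of the triangle
  -- is the one to keep.
  rcases lt_or_gt_of_ne hex with ex | ex <;> rcases lt_or_gt_of_ne hey with ey | ey <;>
    rcases lt_or_gt_of_ne hez with ez | ez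
  · nlinarith [mul_pos p1 (neg_pos.2 ex), mul_pos p2 (neg_pos.2 ey), mul_pos p3 (neg_pos.2 ez)]
  · exact .inr (.inl (mem _ _ p1' ey ez))
  · exact .inl (mem _ _ p3 ex ey)
  · exact .inl (mem _ _ p3 ex ey)
  · rw [Set.pair_comm x z]; exact .inr (.inr (mem _ _ p2' ez ex))
  · exact .inr (.inl (mem _ _ p1' ey ez))
  · rw [Set.pair_comm x z]; exact .inr (.inr (mem _ _ p2' ez ex))
  · nlinarith [mul_pos p1 ex, mul_pos p2 ey, mul_pos p3 ez]

/-! ### Realizations -/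

/-- `w` lies in the closure of `{x, y, z}`, and the four elements are distinct. -/
def Surrounds {J : Type*} (cl : ClosureOperator (Set J)) (x y z w : J) : Prop :=
  x ≠ y ∧ x ≠ z ∧ y ≠ z ∧ w ≠ x ∧ w ≠ y ∧ w ≠ z ∧ w ∈ cl {x, y, z}

open Classical in
theorem mem_rootedTriangles_iff {J : Type*} {cl : ClosureOperator (Set J)} {x y z w : J} :
    (({x, y, z} : Finset J), w) ∈ RootedTriangles cl ↔ Surrounds cl x y z w := by
  unfold RootedTriangles Surrounds
  simp only [Set.mem_ofPred_eq, Finset.card_eq_three, Finset.coe_insert, Finset.coe_singleton,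
    Finset.mem_insert, Finset.mem_singleton, not_or]
  have : (∃ a b c, a ≠ b ∧ a ≠ c ∧ b ≠ c ∧ ({x, y, z} : Finset J) = {a, b, c}) ↔
      x ≠ y ∧ x ≠ z ∧ y ≠ z := by
    rw [← Finset.card_eq_three]
    constructor
    · intro h
      refine ⟨?_, ?_, ?_⟩ <;> rintro rfl <;> simp at h
      · exact absurd h (by have := Finset.card_le_two (a := x) (b := z); omega)
      · exact absurd h (by have := Finset.card_le_two (a := x) (b := y); rw [Finset.pair_comm] at this; omega)
      · exact absurd h (by have := Finset.card_le_two (a := x) (b := y); omega)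
    · exact fun ⟨h1, h2, h3⟩ => Finset.card_eq_three.2 ⟨x, y, z, h1, h2, h3, rfl⟩
  rw [this]
  tauto

section

variable {J : Type*} {cl : ClosureOperator (Set J)} {f : J → Plane}

theorem IsRealization.signedArea_ne_zero (hf : IsRealization cl f) {x y z : J} (hxy : x ≠ y)
    (hxz : x ≠ z) (hyz : y ≠ z) : signedArea (f x) (f y) (f z) ≠ 0 := fun h =>
  hf.generalPosition ⟨x, y, z, hxy, hxz, hyz⟩ (collinear_of_signedArea_eq_zero h)

theorem IsRealization.mem_cl_triple_iff (hf : IsRealization cl f) {x y z w : J} :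
    w ∈ cl {x, y, z} ↔ f w ∈ convexHull ℝ {f x, f y, f z} := by
  rw [hf.mem_cl_iff, Set.image_insert_eq, Set.image_pair]

theorem orderType_eq_one_iff {s : Triple J} :
    orderType f s = 1 ↔ 0 < signedArea (f s.a) (f s.b) (f s.c) := by
  unfold orderType orientationSign
  split_ifs with h <;> simp [h]

theorem units_eq_iff (u v : ℤˣ) : u = v ↔ (u = 1 ↔ v = 1) := by
  rcases Int.units_eq_one_or u with rfl | rfl <;> rcases Int.units_eq_one_or v with rfl | rfl <;>
    decide

theorem orderType_eq_iff {s s' : Triple J} : orderType f s = orderType f s' ↔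
    (0 < signedArea (f s.a) (f s.b) (f s.c) ↔ 0 < signedArea (f s'.a) (f s'.b) (f s'.c)) := by
  rw [units_eq_iff, orderType_eq_one_iff, orderType_eq_one_iff]

theorem units_eq_neg_iff (u v : ℤˣ) : u = -v ↔ (u = 1 ↔ ¬ v = 1) := by
  rcases Int.units_eq_one_or u with rfl | rfl <;> rcases Int.units_eq_one_or v with rfl | rfl <;>
    decide

theorem IsRealization.isAssociated (hf : IsRealization cl f) :
    IsAssociated cl (orderType f) := by
  refine ⟨fun s => ⟨?_, ?_⟩, fun a b c d hab hac hbc had hbd hcd => ?_⟩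
  · rw [units_eq_iff, orderType_eq_one_iff, orderType_eq_one_iff, signedArea_cycle]
  · rw [units_eq_neg_iff, orderType_eq_one_iff, orderType_eq_one_iff, signedArea_swap]
    have := hf.signedArea_ne_zero s.hab s.hac s.hbc
    constructor
    · intro h; linarith
    · intro h; have := lt_of_le_of_ne (not_lt.1 h) this; linarith
  · rw [mem_rootedTriangles_iff]
    simp only [orderType_eq_iff]
    rw [← mem_convexHull_iff_pos
      (hf.signedArea_ne_zero hbd.symm hcd.symm hbc) (hf.signedArea_ne_zero had hac hcd.symm)
      (hf.signedArea_ne_zero hab had hbd), ← hf.mem_cl_triple_iff]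
    simp [Surrounds, hab, hac, hbc, had.symm, hbd.symm, hcd.symm]

theorem IsRealization.surrounds_exchange (hf : IsRealization cl f) {x y z d e : J}
    (h : Surrounds cl x y z d) (hex : e ≠ x) (hey : e ≠ y) (hez : e ≠ z) (hed : e ≠ d) :
    Surrounds cl e x y d ∨ Surrounds cl e y z d ∨ Surrounds cl e x z d := by
  obtain ⟨hxy, hxz, hyz, hdx, hdy, hdz, hd⟩ := h
  have := mem_convexHull_exchange (hf.signedArea_ne_zero hxy hxz hyz)
    (hf.signedArea_ne_zero hdy hdz hyz) (hf.signedArea_ne_zero hdx.symm hxz hdz)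
    (hf.signedArea_ne_zero hxy hdx.symm hdy.symm) (hf.signedArea_ne_zero hed hex hdx)
    (hf.signedArea_ne_zero hed hey hdy) (hf.signedArea_ne_zero hed hez hdz)
    (hf.mem_cl_triple_iff.1 hd)
  simp only [← hf.mem_cl_triple_iff] at this
  simp only [Surrounds]
  tauto

/-- Krein-Milman: the hull of all points is the closed hull of its extreme points, and these are
images of extreme elements. -/
theorem IsRealization.mem_convexHull_outermostLayer [Finite J] (hf : IsRealization cl f) (d : J) :
    f d ∈ convexHull ℝ (f '' outermostLayer cl) := by
  have hfin : (Set.range f).Finite := Set.finite_range f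
  have h1 := closure_convexHull_extremePoints (hfin.isCompact_convexHull ℝ)
    (convex_convexHull ℝ (Set.range f))
  have hsub : (convexHull ℝ (Set.range f)).extremePoints ℝ ⊆ f '' outermostLayer cl := by
    intro p hp
    obtain ⟨x, rfl⟩ := extremePoints_convexHull_subset (𝕜 := ℝ) hp
    refine ⟨x, fun hx => ?_, rfl⟩
    rw [hf.mem_cl_iff] at hx
    refine (((convex_convexHull ℝ _).mem_extremePoints_iff_mem_sdiff_convexHull_sdiff).1 hp).2
      (convexHull_mono ?_ hx)
    rintro _ ⟨y, ⟨-, hy⟩, rfl⟩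
    exact ⟨subset_convexHull ℝ _ ⟨y, rfl⟩, fun h => hy (hf.injective h)⟩
  have h2 : IsClosed (convexHull ℝ (f '' outermostLayer cl)) :=
    (Set.toFinite _).isClosed_convexHull ℝ
  have h3 : f d ∈ closure (convexHull ℝ ((convexHull ℝ (Set.range f)).extremePoints ℝ)) := by
    rw [h1]; exact subset_convexHull ℝ _ ⟨d, rfl⟩
  exact closure_minimal (convexHull_mono hsub) h2 h3

/-- An element that is not extreme is surrounded by three extreme elements. -/
theorem IsRealization.exists_surrounds [Finite J] (hf : IsRealization cl f) {d : J}
    (hd : d ∉ outermostLayer cl) :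
    ∃ x ∈ outermostLayer cl, ∃ y ∈ outermostLayer cl, ∃ z ∈ outermostLayer cl,
      Surrounds cl x y z d := by
  have h := hf.mem_convexHull_outermostLayer d
  -- Carathéodory: affinely independent points suffice, at most three in the plane. General position
  -- and injectivity exclude fewer than three.
  rw [convexHull_eq_union (𝕜 := ℝ)] at h
  simp only [Set.mem_iUnion] at h
  obtain ⟨t, hts, hind, hmem⟩ := h
  have hcard : t.card ≤ 3 := by
    have := hind.card_le_finrank_succ
    have h2 : Module.finrank ℝ (vectorSpan ℝ (Set.range ((↑) : t → Plane))) ≤ 2 :=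
      (Submodule.finrank_le _).trans (by simp)
    simp only [Fintype.card_coe] at this
    omega
  classical
  have hpre : ∀ p ∈ t, ∃ x ∈ outermostLayer cl, x ≠ d ∧ f x = p := fun p hp => by
    obtain ⟨x, hx, rfl⟩ := hts hp
    exact ⟨x, hx, fun h => hd (h ▸ hx), rfl⟩
  have hlt : t.card = 0 ∨ t.card = 1 ∨ t.card = 2 ∨ t.card = 3 := by omega
  rcases hlt with h | h | h | h
  · rw [Finset.card_eq_zero] at h; subst h; simp at hmem
  · obtain ⟨p, rfl⟩ := Finset.card_eq_one.1 h
    obtain ⟨x, hx, hxd, rfl⟩ := hpre p (by simp)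
    simp only [Finset.coe_singleton, convexHull_singleton, Set.mem_singleton_iff] at hmem
    exact absurd (hf.injective hmem).symm hxd
  · obtain ⟨p, q, hpq, rfl⟩ := Finset.card_eq_two.1 h
    obtain ⟨x, hx, hxd, rfl⟩ := hpre p (by simp)
    obtain ⟨y, hy, hyd, rfl⟩ := hpre q (by simp)
    simp only [Finset.coe_insert, Finset.coe_singleton, convexHull_pair,
      mem_segment_iff_wbtw] at hmem
    exact absurd hmem.collinear
      (hf.generalPosition ⟨x, d, y, hxd, fun h => hpq (h ▸ rfl), hyd.symm⟩)
  · obtain ⟨p, q, r, hpq, hpr, hqr, rfl⟩ := Finset.card_eq_three.1 h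
    obtain ⟨x, hx, hxd, rfl⟩ := hpre p (by simp)
    obtain ⟨y, hy, hyd, rfl⟩ := hpre q (by simp)
    obtain ⟨z, hz, hzd, rfl⟩ := hpre r (by simp)
    simp only [Finset.coe_insert, Finset.coe_singleton] at hmem
    exact ⟨x, hx, y, hy, z, hz, fun h => hpq (h ▸ rfl), fun h => hpr (h ▸ rfl),
      fun h => hqr (h ▸ rfl), hxd.symm, hyd.symm, hzd.symm, hf.mem_cl_triple_iff.2 hmem⟩

end

end ConvexGeom

namespace ConvexGeom

/-! ### Propagation of orientations

The propagated orientations are recorded by a relation `T`: it holds at `(x, y, z)` if the value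
at `(x, y, z)` is known to be `1`. -/

section

variable {J : Type*}

/-- One of `x, y, z, w` is surrounded by the other three. -/
def NonConvexQuad (R : J → J → J → J → Prop) (x y z w : J) : Prop :=
  R x y z w ∨ R y z w x ∨ R x z w y ∨ R x y w z

/-- One round of propagation. -/
def propagate (R : J → J → J → J → Prop) (T : J → J → J → Prop) (x y z : J) : Prop :=
  T x y z ∨ T y z x ∨ T z x y ∨ ∃ w, R x y w z ∧ T x y w ∨
    (T x y w ∨ T y x w) ∧ (T x z w ∨ T z x w) ∧ (T y z w ∨ T z y w) ∧
      (T x y w ↔ (T x z w ↔ (T y z w ↔ ¬NonConvexQuad R x y z w)))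

/-- The triples of distinct elements at which an orientation with quasi rooted triangles `R` is
`1`. -/
structure IsOrientation (R : J → J → J → J → Prop) (τ : J → J → J → Prop) : Prop where
  distinct : ∀ x y z, τ x y z → x ≠ y ∧ x ≠ z ∧ y ≠ z
  cycle : ∀ x y z, τ x y z → τ y z x
  swap : ∀ x y z, x ≠ y → x ≠ z → y ≠ z → (τ x z y ↔ ¬τ x y z)
  rooted_iff : ∀ x y z w, x ≠ y → x ≠ z → y ≠ z → x ≠ w → y ≠ w → z ≠ w →
    (R x y z w ↔ (τ x y z ↔ τ w y z) ∧ (τ x y z ↔ τ x w z) ∧ (τ x y z ↔ τ x y w))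

variable {R : J → J → J → J → Prop} {τ T : J → J → J → Prop}

theorem IsOrientation.cycle_iff (hτ : IsOrientation R τ) {x y z : J} : τ y z x ↔ τ x y z :=
  ⟨fun h => hτ.cycle _ _ _ (hτ.cycle _ _ _ h), hτ.cycle _ _ _⟩

theorem IsOrientation.swap_left (hτ : IsOrientation R τ) {x y z : J} (hxy : x ≠ y) (hxz : x ≠ z)
    (hyz : y ≠ z) : τ y x z ↔ ¬τ x y z := by
  rw [← hτ.cycle_iff, hτ.swap x y z hxy hxz hyz]

/-- The `rooted_iff` axiom expresses each of the four ways to be nonconvex by the four signs. Over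
all sixteen sign patterns, the product of the signs is `-1` exactly when one of these ways occurs.
-/
theorem IsOrientation.parity (hτ : IsOrientation R τ) {x y z w : J} (hxy : x ≠ y) (hxz : x ≠ z)
    (hyz : y ≠ z) (hxw : x ≠ w) (hyw : y ≠ w) (hzw : z ≠ w) :
    τ x y z ↔ (τ x y w ↔ (τ x z w ↔ (τ y z w ↔ ¬NonConvexQuad R x y z w))) := by
  have h1 := hτ.rooted_iff x y z w hxy hxz hyz hxw hyw hzw
  have h2 := hτ.rooted_iff y z w x hyz hyw hzw hxy.symm hxz.symm hxw.symm
  have h3 := hτ.rooted_iff x z w y hxz hxw hzw hxy hyz.symm hyw.symm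
  have h4 := hτ.rooted_iff x y w z hxy hxw hyw hxz hyz hzw.symm
  have a1 : τ w y z ↔ τ y z w := (hτ.cycle_iff).symm
  have a2 : τ x w z ↔ ¬τ x z w := hτ.swap x z w hxz hxw hzw
  have a3 : τ y x w ↔ ¬τ x y w := hτ.swap_left hxy hxw hyw
  have a4 : τ y z x ↔ τ x y z := hτ.cycle_iff
  have a5 : τ x z y ↔ ¬τ x y z := hτ.swap x y z hxy hxz hyz
  have a6 : τ z y w ↔ ¬τ y z w := hτ.swap_left hyz hyw hzw
  rw [a1, a2] at h1
  rw [a3, a4] at h2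
  rw [a5] at h3
  rw [a6] at h4
  unfold NonConvexQuad
  rw [h1, h2, h3, h4]
  by_cases b1 : τ x y z <;> by_cases b2 : τ x y w <;> by_cases b3 : τ x z w <;>
    by_cases b4 : τ y z w <;> simp only [b1, b2, b3, b4] <;> decide

/-- Soundness of one round: each rule is a consequence of the axioms of `IsOrientation`. -/
theorem IsOrientation.propagate_le (hτ : IsOrientation R τ)
    (hR : ∀ x y z w, R x y z w → w ≠ x ∧ w ≠ y ∧ w ≠ z)
    (h : ∀ x y z, T x y z → τ x y z) (x y z : J) (hp : propagate R T x y z) : τ x y z := by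
  rcases hp with hp | hp | hp | ⟨w, ⟨hr, hp⟩ | ⟨h1, h2, h3, h4⟩⟩
  · exact h _ _ _ hp
  · exact hτ.cycle_iff.1 (h _ _ _ hp)
  · exact hτ.cycle _ _ _ (h _ _ _ hp)
  · obtain ⟨hxy, hxw, hyw⟩ := hτ.distinct _ _ _ (h _ _ _ hp)
    obtain ⟨hzx, hzy, hzw⟩ := hR _ _ _ _ hr
    exact ((hτ.rooted_iff x y w z hxy hxw hyw hzx.symm hzy.symm hzw.symm).1 hr).2.2.1 (h _ _ _ hp)
  · have dist : ∀ u v, T u v w ∨ T v u w → u ≠ v ∧ u ≠ w ∧ v ≠ w := by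
      rintro u v (h' | h')
      · exact hτ.distinct _ _ _ (h _ _ _ h')
      · obtain ⟨h1, h2, h3⟩ := hτ.distinct _ _ _ (h _ _ _ h')
        exact ⟨h1.symm, h3, h2⟩
    have val : ∀ u v, T u v w ∨ T v u w → (T u v w ↔ τ u v w) := fun u v h' => by
      obtain ⟨d1, d2, d3⟩ := dist u v h'
      have := hτ.swap_left d1 d2 d3
      have := h u v w
      have := h v u w
      tauto
    obtain ⟨hxy, hxw, hyw⟩ := dist _ _ h1
    obtain ⟨hxz, -, hzw⟩ := dist _ _ h2
    rw [hτ.parity hxy hxz (dist _ _ h3).1 hxw hyw hzw, ← val _ _ h1, ← val _ _ h2, ← val _ _ h3]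
    exact h4

theorem IsOrientation.iterate_propagate_le (hτ : IsOrientation R τ)
    (hR : ∀ x y z w, R x y z w → w ≠ x ∧ w ≠ y ∧ w ≠ z)
    (h : ∀ x y z, T x y z → τ x y z) (k : ℕ) :
    ∀ x y z, (propagate R)^[k] T x y z → τ x y z := by
  induction k with
  | zero => exact h
  | succ k ih =>
    rw [Function.iterate_succ_apply']
    exact hτ.propagate_le hR ih

/-- The value is known for some arrangement of `x, y, z`. -/
def Known (T : J → J → J → Prop) (x y z : J) : Prop :=
  T x y z ∨ T y z x ∨ T z x y ∨ T y x z ∨ T x z y ∨ T z y x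

theorem Known.cycle {x y z : J} (h : Known T x y z) : Known T y z x := by
  unfold Known at *; tauto

theorem Known.swap {x y z : J} (h : Known T x y z) : Known T x z y := by
  unfold Known at *; tauto

theorem Known.propagate {x y z : J} (h : Known T x y z) :
    propagate R T x y z ∨ propagate R T y x z := by
  unfold Known at h; unfold ConvexGeom.propagate; tauto

/-- One round rotates the known arrangement into `(x, y, w)` or `(y, x, w)`; the next applies the
rule for a surrounded element. -/
theorem Known.propagate_surrounded {x y z w : J} (h : Known T x y w) (hr : R x y w z)
    (hr' : R y x w z) : Known (ConvexGeom.propagate R (ConvexGeom.propagate R T)) x y z := by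
  rcases h.propagate (R := R) with h | h
  · exact .inl (.inr (.inr (.inr ⟨w, .inl ⟨hr, h⟩⟩)))
  · exact .inr (.inr (.inr (.inl (.inr (.inr (.inr ⟨w, .inl ⟨hr', h⟩⟩))))))

theorem not_iff_swap {p q r s : Prop} (h : ¬(p ↔ (q ↔ (r ↔ s)))) : ¬p ↔ (r ↔ (q ↔ s)) := by
  tauto

/-- After one round for rotation, the parity rule derives `(x, y, z)` or, if its condition fails,
`(y, x, z)`. Soundness of `T` ensures that the two orders of a known triple are not both derived, so
interchanging `x` and `y` negates the condition. -/
theorem IsOrientation.known_propagate (hτ : IsOrientation R τ)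
    (hT : ∀ x y z, T x y z → τ x y z)
    (hR : ∀ x y z w, R x y z w → w ≠ x ∧ w ≠ y ∧ w ≠ z)
    (hsymm : ∀ x y z w, R x y z w → R y x z w ∧ R x z y w) {x y z w : J}
    (h1 : Known T x y w) (h2 : Known T x z w) (h3 : Known T y z w) :
    Known (propagate R (propagate R T)) x y z := by
  have hT' : ∀ x y z, propagate R T x y z → τ x y z := hτ.propagate_le hR hT
  have k1 := h1.propagate (R := R)
  have k2 := h2.propagate (R := R)
  have k3 := h3.propagate (R := R)
  set S := propagate R T
  have anti : ∀ u v, S u v w → ¬S v u w := fun u v h h' => by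
    obtain ⟨d1, d2, d3⟩ := hτ.distinct _ _ _ (hT' _ _ _ h)
    exact (hτ.swap_left d1 d2 d3).1 (hT' _ _ _ h') (hT' _ _ _ h)
  have n1 := anti x y
  have hq : NonConvexQuad R y x z w ↔ NonConvexQuad R x y z w := by
    have sw : ∀ x y z w, R x y z w ↔ R y x z w := fun x y z w =>
      ⟨fun h => (hsymm _ _ _ _ h).1, fun h => (hsymm _ _ _ _ h).1⟩
    unfold NonConvexQuad
    rw [sw y x z w, sw y x w z]
    tauto
  by_cases hp : S x y w ↔ (S x z w ↔ (S y z w ↔ ¬NonConvexQuad R x y z w))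
  · exact .inl (.inr (.inr (.inr ⟨w, .inr ⟨k1, k2, k3, hp⟩⟩)))
  · refine .inr (.inr (.inr (.inl (.inr (.inr (.inr ⟨w, .inr ⟨k1.symm, k3, k2, ?_⟩⟩))))))
    rw [hq]
    rw [show S y x w ↔ ¬S x y w from ⟨fun h h' => n1 h' h, k1.resolve_left⟩]
    exact not_iff_swap hp

/-- Eleven rounds of propagation determine an orientation, if it is known on the extreme
elements `H`, all others are surrounded by extreme elements, and elements can be exchanged. -/
theorem IsOrientation.known_all (hτ : IsOrientation R τ) {H : Set J}
    (hT : ∀ x y z, T x y z → τ x y z)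
    (hR : ∀ x y z w, R x y z w → x ≠ y ∧ x ≠ z ∧ y ≠ z ∧ w ≠ x ∧ w ≠ y ∧ w ≠ z)
    (hsymm : ∀ x y z w, R x y z w → R y x z w ∧ R x z y w)
    (hH : ∀ x ∈ H, ∀ y ∈ H, ∀ z ∈ H, x ≠ y → x ≠ z → y ≠ z → Known T x y z)
    (hin : ∀ d, d ∉ H → ∃ x ∈ H, ∃ y ∈ H, ∃ z ∈ H, R x y z d)
    (hex : ∀ x y z d e, R x y z d → e ≠ x → e ≠ y → e ≠ z → e ≠ d →
      R e x y d ∨ R e y z d ∨ R e x z d) {x y z : J} (hxy : x ≠ y) (hxz : x ≠ z) (hyz : y ≠ z) :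
    (propagate R)^[11] T x y z ∨ (propagate R)^[11] T y x z := by
  have hR' : ∀ x y z w, R x y z w → w ≠ x ∧ w ≠ y ∧ w ≠ z := fun x y z w h => (hR x y z w h).2.2.2
  -- Each inference takes two rounds, one to rotate and one to apply the rule, so `K` counts rounds
  -- in pairs.
  let K : ℕ → J → J → J → Prop := fun k => Known ((propagate R)^[2 * k] T)
  have hsurr : ∀ {k x y z w}, K k x y w → R x y w z → K (k + 1) x y z := fun {k} _ _ _ _ h hr => by
    have := Known.propagate_surrounded h hr (hsymm _ _ _ _ hr).1
    simpa only [K, mul_add, mul_one, Function.iterate_succ_apply'] using this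
  have hquad : ∀ {k x y z w}, K k x y w → K k x z w → K k y z w → K (k + 1) x y z :=
    fun {k} _ _ _ _ h1 h2 h3 => by
      have := hτ.known_propagate (hτ.iterate_propagate_le hR' hT (2 * k)) hR' hsymm h1 h2 h3
      simpa only [K, mul_add, mul_one, Function.iterate_succ_apply'] using this
  have hmono1 : ∀ {k x y z}, K k x y z → K (k + 1) x y z := fun {k x y z} h => by
    have mono : ∀ {S : J → J → J → Prop}, Known S x y z → Known (propagate R S) x y z := by
      intro S h
      rcases h.propagate (R := R) with h | h
      · exact .inl h
      · exact .inr (.inr (.inr (.inl h)))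
    simpa only [K, mul_add, mul_one, Function.iterate_succ_apply'] using mono (mono h)
  have hmono : ∀ {k l x y z}, k ≤ l → K k x y z → K l x y z := fun {k l _ _ _} hkl h => by
    induction hkl with
    | refl => exact h
    | step _ ih => exact hmono1 ih
  -- one element that is not extreme
  have one : ∀ d, d ∉ H → ∀ e ∈ H, ∀ e' ∈ H, e ≠ e' → K 2 d e e' := by
    intro d hd e he e' he' hee
    obtain ⟨x, hx, y, hy, z, hz, hr⟩ := hin d hd
    let N : J → J → Prop := fun e u => u = e ∨ K 1 e u d
    have direct : ∀ e ∈ H, ∀ u ∈ H, ∀ v ∈ H, R e u v d → N e u := fun e he u hu v hv h =>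
      .inr (hsurr (hH e he u hu v hv (hR _ _ _ _ h).1 (hR _ _ _ _ h).2.1 (hR _ _ _ _ h).2.2.1) h)
    -- By exchange, `e` and two of `x, y, z` surround `d`, which gives the signs of `d, e` with each
    -- of these two.
    have hN : ∀ e ∈ H, N e x ∧ N e y ∨ N e y ∧ N e z ∨ N e x ∧ N e z := by
      intro e he
      have hed : e ≠ d := fun h => hd (h ▸ he)
      by_cases hex' : e = x
      · exact .inl ⟨.inl hex'.symm, hex' ▸ direct x hx y hy z hz hr⟩
      by_cases hey' : e = y
      · exact .inl ⟨hey' ▸ direct y hy x hx z hz (hsymm _ _ _ _ hr).1, .inl hey'.symm⟩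
      by_cases hez' : e = z
      · exact .inr (.inl ⟨hez' ▸ direct z hz y hy x hx
          (hsymm _ _ _ _ (hsymm _ _ _ _ (hsymm _ _ _ _ hr).1).2).1, .inl hez'.symm⟩)
      rcases hex _ _ _ _ _ hr hex' hey' hez' hed with h | h | h
      · exact .inl ⟨direct e he x hx y hy h, direct e he y hy x hx (hsymm _ _ _ _ h).2⟩
      · exact .inr (.inl ⟨direct e he y hy z hz h, direct e he z hz y hy (hsymm _ _ _ _ h).2⟩)
      · exact .inr (.inr ⟨direct e he x hx z hz h, direct e he z hz x hx (hsymm _ _ _ _ h).2⟩)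
    -- Two pairs from `x, y, z` share an element `u`. The parity rule on `d, e, e', u` then settles
    -- `d, e, e'`.
    obtain ⟨u, hu, h, h'⟩ : ∃ u ∈ H, N e u ∧ N e' u := by
      rcases hN e he with ⟨h1, h2⟩ | ⟨h1, h2⟩ | ⟨h1, h2⟩ <;>
        rcases hN e' he' with ⟨h3, h4⟩ | ⟨h3, h4⟩ | ⟨h3, h4⟩ <;>
        first
        | exact ⟨x, hx, by assumption, by assumption⟩
        | exact ⟨y, hy, by assumption, by assumption⟩
        | exact ⟨z, hz, by assumption, by assumption⟩
    rcases h with rfl | h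
    · rcases h' with rfl | h'
      · exact absurd rfl hee
      · exact hmono1 h'.cycle.cycle.swap
    · rcases h' with rfl | h'
      · exact hmono1 h.cycle.cycle
      · have hne : ∀ e, K 1 e u d → e ≠ u := fun e h => by
          have hs := hτ.iterate_propagate_le hR' hT 2
          have key : ∀ {a b c}, (propagate R)^[2] T a b c → a ≠ b ∧ a ≠ c ∧ b ≠ c := fun h =>
            hτ.distinct _ _ _ (hs _ _ _ h)
          rcases h with h | h | h | h | h | h <;> have := key h <;> tauto
        have h0 : K 1 e e' u := hmono (Nat.zero_le 1) (hH e he e' he' u hu hee (hne e h) (hne e' h'))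
        exact hquad h.cycle.cycle.swap.swap h'.cycle.cycle h0
  -- two elements that are not extreme
  have two : ∀ d, d ∉ H → ∀ d', d' ∉ H → d ≠ d' → ∀ a ∈ H, K 4 d d' a := by
    intro d hd d' hd' hdd a ha
    obtain ⟨x, hx, y, hy, z, hz, hr⟩ := hin d' hd'
    have hne : ∀ u ∈ H, d ≠ u := fun u hu h => hd (h ▸ hu)
    -- Exchange puts `d` itself at a vertex of a triangle around `d'`, so the previous case applies
    -- to this triangle.
    obtain ⟨u, hu, v, hv, hr⟩ : ∃ u ∈ H, ∃ v ∈ H, R d u v d' := by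
      rcases hex _ _ _ _ _ hr (hne x hx) (hne y hy) (hne z hz) hdd with h | h | h
      · exact ⟨x, hx, y, hy, h⟩
      · exact ⟨y, hy, z, hz, h⟩
      · exact ⟨x, hx, z, hz, h⟩
    have h3 : K 3 d u d' := hsurr (one d hd u hu v hv (hR _ _ _ _ hr).2.2.1) hr
    by_cases hau : a = u
    · exact hau ▸ hmono1 h3.swap
    · exact hquad h3.swap (hmono1 (one d hd a ha u hu hau)) (hmono1 (one d' hd' a ha u hu hau))
  have all : K 5 x y z := by
    have three : ∀ d, d ∉ H → ∀ d', d' ∉ H → ∀ d'', d'' ∉ H → d ≠ d' → d ≠ d'' → d' ≠ d'' →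
        K 5 d d' d'' := by
      intro d hd d' hd' d'' hd'' h1 h2 h3
      obtain ⟨a, ha, -⟩ := hin d hd
      exact hquad (two d hd d' hd' h1 a ha) (two d hd d'' hd'' h2 a ha) (two d' hd' d'' hd'' h3 a ha)
    by_cases hx : x ∈ H <;> by_cases hy : y ∈ H <;> by_cases hz : z ∈ H
    · exact hmono (Nat.zero_le 5) (hH x hx y hy z hz hxy hxz hyz)
    · exact hmono (k := 2) (by norm_num) (one z hz x hx y hy hxy).cycle
    · exact hmono (k := 2) (by norm_num) (one y hy x hx z hz hxz).swap.cycle.cycle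
    · exact hmono (k := 4) (by norm_num) (two y hy z hz hyz x hx).cycle.cycle
    · exact hmono (k := 2) (by norm_num) (one x hx y hy z hz hyz)
    · exact hmono (k := 4) (by norm_num) (two x hx z hz hxz y hy).swap
    · exact hmono (k := 4) (by norm_num) (two x hx y hy hxy z hz)
    · exact three x hx y hy z hz hxy hxz hyz
  -- Ten rounds make some arrangement known; the eleventh rotates it.
  have := all.propagate (R := R)
  simpa only [← Function.iterate_succ_apply' (propagate R)] using this

end

end ConvexGeom

/-! ### Formulas for the start, the rounds and the test. -/

namespace RAM.Formula

/-- Disjunction. -/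
def or (φ ψ : Formula) : Formula := .not (.and (.not φ) (.not ψ))

/-- Implication. -/
def imp (φ ψ : Formula) : Formula := .not (.and φ (.not ψ))

/-- Equivalence. -/
def iff (φ ψ : Formula) : Formula := .and (φ.imp ψ) (ψ.imp φ)

/-- Universal quantification. -/
def all (φ : Formula) : Formula := .not (.ex (.not φ))

/-- Two variables have different values. -/
def ne (u v : ℕ) : Formula := or (.lt u v) (.lt v u)

section

variable {n m d : ℕ} {M : ℕ → ℕ → ℕ} {x : ℕ → ℕ} {φ ψ : Formula}

theorem holds_or : (or φ ψ).Holds n m M d x ↔ φ.Holds n m M d x ∨ ψ.Holds n m M d x := by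
  simp only [or, Holds]; tauto

theorem holds_imp : (imp φ ψ).Holds n m M d x ↔ (φ.Holds n m M d x → ψ.Holds n m M d x) := by
  simp only [imp, Holds]; tauto

theorem holds_iff : (iff φ ψ).Holds n m M d x ↔ (φ.Holds n m M d x ↔ ψ.Holds n m M d x) := by
  simp only [iff, Holds, holds_imp]; tauto

theorem holds_all : (all φ).Holds n m M d x ↔
    ∀ y < n, φ.Holds n m M (d + 1) (Function.update x d y) := by
  simp only [all, Holds]; push Not; rfl

theorem holds_ne {u v : ℕ} : (ne u v).Holds n m M d x ↔ x u ≠ x v := by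
  simp only [ne, Holds, holds_or]; omega

end

/-- The triples `(a j, a i, a k)` with `i < j < k`, where `a` is the list in array `0`. -/
def hullFormula : Formula :=
  .ex (.ex (.ex (.and (.lt 3 4) (.and (.lt 4 5) (.and (.ltSize 5)
    (.and (.listEq 4 0) (.and (.listEq 3 1) (.listEq 5 2))))))))

/-- One round of propagation, from the table in array `A`. -/
def propagateFormula (A : ℕ) : Formula :=
  or (.tab A [0, 1, 2]) (or (.tab A [1, 2, 0]) (or (.tab A [2, 0, 1]) (.ex (or
    (.and (.tab 1 [0, 1, 3, 2]) (.tab A [0, 1, 3]))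
    (.and (or (.tab A [0, 1, 3]) (.tab A [1, 0, 3]))
      (.and (or (.tab A [0, 2, 3]) (.tab A [2, 0, 3]))
        (.and (or (.tab A [1, 2, 3]) (.tab A [2, 1, 3]))
          (iff (.tab A [0, 1, 3]) (iff (.tab A [0, 2, 3]) (iff (.tab A [1, 2, 3])
            (.not (or (.tab 1 [0, 1, 2, 3]) (or (.tab 1 [1, 2, 3, 0])
              (or (.tab 1 [0, 2, 3, 1]) (.tab 1 [0, 1, 3, 2])))))))))))))))

/-- The table in array `A` is alternating, and its quasi rooted triangles are those in
array `1`. -/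
def checkFormula (A : ℕ) : Formula :=
  all (all (all (imp (ne 0 1) (imp (ne 0 2) (imp (ne 1 2)
    (.and (iff (.tab A [0, 1, 2]) (.tab A [1, 2, 0]))
      (.and (iff (.tab A [0, 2, 1]) (.not (.tab A [0, 1, 2])))
        (all (imp (ne 0 3) (imp (ne 1 3) (imp (ne 2 3)
          (iff (.tab 1 [0, 1, 2, 3]) (.and (iff (.tab A [0, 1, 2]) (.tab A [3, 1, 2]))
            (.and (iff (.tab A [0, 1, 2]) (.tab A [0, 3, 2]))
              (iff (.tab A [0, 1, 2]) (.tab A [0, 1, 3]))))))))))))))))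

theorem wellScoped_hullFormula : hullFormula.WellScoped 3 := by
  simp [hullFormula, WellScoped]

theorem wellScoped_propagateFormula (A : ℕ) : (propagateFormula A).WellScoped 3 := by
  simp [propagateFormula, WellScoped, or, iff, imp]

theorem wellScoped_checkFormula (A : ℕ) : (checkFormula A).WellScoped 0 := by
  simp [checkFormula, WellScoped, or, iff, imp, all, ne]

end RAM.Formula

/-! ### Associated functions and the propagated relation. -/

namespace ConvexGeom

open RAM RAM.Formula

/-- `t` is `1` at `(x, y, z)`. -/
def IsPositive {J : Type*} (t : Triple J → ℤˣ) (x y z : J) : Prop :=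
  ∃ (hxy : x ≠ y) (hxz : x ≠ z) (hyz : y ≠ z), t ⟨x, y, z, hxy, hxz, hyz⟩ = 1

/-- The anticlockwise triples of extreme elements from which the propagation starts. -/
def HullTriple {J : Type*} {m : ℕ} (a : Fin m → J) (x y z : J) : Prop :=
  ∃ i j k : Fin m, i < j ∧ j < k ∧ a j = x ∧ a i = y ∧ a k = z

/-- `T` is alternating, and its quasi rooted triangles are given by `R`. -/
def Consistent {J : Type*} (R : J → J → J → J → Prop) (T : J → J → J → Prop) : Prop :=
  ∀ x y z, x ≠ y → x ≠ z → y ≠ z → (T x y z ↔ T y z x) ∧ (T x z y ↔ ¬T x y z) ∧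
    ∀ w, x ≠ w → y ≠ w → z ≠ w →
      (R x y z w ↔ (T x y z ↔ T w y z) ∧ (T x y z ↔ T x w z) ∧ (T x y z ↔ T x y w))

section

variable {J : Type*} {cl : ClosureOperator (Set J)} {t : Triple J → ℤˣ}

theorem isPositive_iff {x y z : J} (hxy : x ≠ y) (hxz : x ≠ z) (hyz : y ≠ z) :
    IsPositive t x y z ↔ t ⟨x, y, z, hxy, hxz, hyz⟩ = 1 :=
  ⟨fun ⟨_, _, _, h⟩ => h, fun h => ⟨hxy, hxz, hyz, h⟩⟩

theorem IsAssociated.isOrientation (h : IsAssociated cl t) :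
    IsOrientation (Surrounds cl) (IsPositive t) where
  distinct := fun _ _ _ ⟨h1, h2, h3, _⟩ => ⟨h1, h2, h3⟩
  cycle := fun x y z ⟨h1, h2, h3, h4⟩ =>
    ⟨h3, h1.symm, h2.symm, ((h.1 ⟨x, y, z, h1, h2, h3⟩).1).trans h4⟩
  swap := fun x y z h1 h2 h3 => by
    rw [isPositive_iff h1 h2 h3, isPositive_iff h2 h1 h3.symm, ← units_eq_neg_iff]
    exact (h.1 ⟨x, y, z, h1, h2, h3⟩).2
  rooted_iff := fun x y z w hxy hxz hyz hxw hyw hzw => by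
    rw [← mem_rootedTriangles_iff, h.2 x y z w hxy hxz hyz hxw hyw hzw,
      isPositive_iff hxy hxz hyz, isPositive_iff hyw.symm hzw.symm hyz,
      isPositive_iff hxw hxz hzw.symm, isPositive_iff hxy hxw hyw, units_eq_iff,
      units_eq_iff (t ⟨x, y, z, hxy, hxz, hyz⟩) (t ⟨x, w, z, _, _, _⟩),
      units_eq_iff (t ⟨x, y, z, hxy, hxz, hyz⟩) (t ⟨x, y, w, _, _, _⟩)]

theorem SupportsClockwise.isPositive_of_hullTriple {m : ℕ} {a : Fin m → J}
    (ha : Function.Injective a) (h : IsAssociated cl t) (hs : SupportsClockwise t a) (x y z : J)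
    (hT : HullTriple a x y z) : IsPositive t x y z := by
  obtain ⟨i, j, k, hij, hjk, rfl, rfl, rfl⟩ := hT
  have h1 : a i ≠ a j := ha.ne hij.ne
  have h2 : a i ≠ a k := ha.ne (hij.trans hjk).ne
  have h3 : a j ≠ a k := ha.ne hjk.ne
  rw [h.isOrientation.swap_left h1 h2 h3, isPositive_iff h1 h2 h3, hs i j k (.inl ⟨hij, hjk⟩)]
  decide

theorem Surrounds.symm {x y z w : J} (h : Surrounds cl x y z w) :
    Surrounds cl y x z w ∧ Surrounds cl x z y w := by
  obtain ⟨h1, h2, h3, h4, h5, h6, h7⟩ := h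
  exact ⟨⟨h1.symm, h3, h2, h5, h4, h6, by rwa [Set.insert_comm]⟩,
    ⟨h2, h1, h3.symm, h4, h6, h5, by rwa [Set.pair_comm]⟩⟩

theorem known_hullTriple {m : ℕ} {a : Fin m → J} {x y z : J} (hx : x ∈ Set.range a)
    (hy : y ∈ Set.range a) (hz : z ∈ Set.range a) (hxy : x ≠ y) (hxz : x ≠ z) (hyz : y ≠ z) :
    Known (HullTriple a) x y z := by
  obtain ⟨i, rfl⟩ := hx
  obtain ⟨j, rfl⟩ := hy
  obtain ⟨k, rfl⟩ := hz
  have key : ∀ i j k : Fin m, i < j → j < k → HullTriple a (a j) (a i) (a k) :=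
    fun i j k h1 h2 => ⟨i, j, k, h1, h2, rfl, rfl, rfl⟩
  have h1 : i ≠ j := fun h => hxy (h ▸ rfl)
  have h2 : i ≠ k := fun h => hxz (h ▸ rfl)
  have h3 : j ≠ k := fun h => hyz (h ▸ rfl)
  unfold Known
  rcases lt_or_gt_of_ne h1 with h1 | h1 <;> rcases lt_or_gt_of_ne h2 with h2 | h2 <;>
    rcases lt_or_gt_of_ne h3 with h3 | h3
  · have := key _ _ _ h1 h3; tauto
  · have := key _ _ _ h2 h3; tauto
  · exact absurd (h1.trans h3) h2.asymm
  · have := key _ _ _ h2 h1; tauto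
  · have := key _ _ _ h1 h2; tauto
  · exact absurd (h3.trans h1) h2.asymm
  · have := key _ _ _ h3 h2; tauto
  · have := key _ _ _ h3 h1; tauto

/-- The propagation determines the order type of every realization. -/
theorem IsRealizationWithOrder.propagate_iff [Finite J] {m : ℕ} {a : Fin m → J}
    (ha : IsCircularListing cl a) {f : J → Plane} (hf : IsRealizationWithOrder cl a f) {x y z : J}
    (hxy : x ≠ y) (hxz : x ≠ z) (hyz : y ≠ z) :
    (propagate (Surrounds cl))^[11] (HullTriple a) x y z ↔ IsPositive (orderType f) x y z := by
  have hτ := hf.1.isAssociated.isOrientation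
  have hT := hf.2.isPositive_of_hullTriple ha.1 hf.1.isAssociated
  have hR : ∀ x y z w, Surrounds cl x y z w →
      x ≠ y ∧ x ≠ z ∧ y ≠ z ∧ w ≠ x ∧ w ≠ y ∧ w ≠ z :=
    fun x y z w ⟨h1, h2, h3, h4, h5, h6, _⟩ => ⟨h1, h2, h3, h4, h5, h6⟩
  have hle := hτ.iterate_propagate_le (fun x y z w h => (hR x y z w h).2.2.2) hT 11
  refine ⟨hle x y z, fun h => ?_⟩
  -- Completeness yields the sign of `(x, y, z)` or of `(y, x, z)`; by soundness, the second
  -- contradicts `h`.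
  refine (hτ.known_all (H := outermostLayer cl) hT hR (fun _ _ _ _ h => h.symm) ?_
    (fun d hd => hf.1.exists_surrounds hd) (fun _ _ _ _ _ => hf.1.surrounds_exchange)
    hxy hxz hyz).resolve_right fun h' => ?_
  · rw [← ha.2]
    exact fun x hx y hy z hz => known_hullTriple hx hy hz
  · exact (hτ.swap_left hxy hxz hyz).1 (hle _ _ _ h') h

theorem IsOrientation.consistent {R : J → J → J → J → Prop} {τ T : J → J → J → Prop}
    (hτ : IsOrientation R τ) (h : ∀ x y z, x ≠ y → x ≠ z → y ≠ z → (T x y z ↔ τ x y z)) :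
    Consistent R T := by
  intro x y z hxy hxz hyz
  refine ⟨?_, ?_, fun w hxw hyw hzw => ?_⟩
  · rw [h _ _ _ hxy hxz hyz, h _ _ _ hyz hxy.symm hxz.symm]
    exact hτ.cycle_iff.symm
  · rw [h _ _ _ hxy hxz hyz, h _ _ _ hxz hxy hyz.symm, hτ.swap _ _ _ hxy hxz hyz]
  · rw [h _ _ _ hxy hxz hyz, h _ _ _ hyw.symm hzw.symm hyz, h _ _ _ hxw hxz hzw.symm,
      h _ _ _ hxy hxw hyw, hτ.rooted_iff _ _ _ _ hxy hxz hyz hxw hyw hzw]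

open Classical in
/-- The orientation with the positive triples `T`. -/
noncomputable def ofPositive (T : J → J → J → Prop) (q : Triple J) : ℤˣ :=
  if T q.a q.b q.c then 1 else -1

theorem ofPositive_eq_one_iff {T : J → J → J → Prop} {q : Triple J} :
    ofPositive T q = 1 ↔ T q.a q.b q.c := by
  unfold ofPositive
  split_ifs with h <;> simp [h]

theorem Consistent.isAssociated {T : J → J → J → Prop} (h : Consistent (Surrounds cl) T) :
    IsAssociated cl (ofPositive T) := by
  refine ⟨fun s => ⟨?_, ?_⟩, fun x y z w hxy hxz hyz hxw hyw hzw => ?_⟩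
  · rw [units_eq_iff, ofPositive_eq_one_iff, ofPositive_eq_one_iff]
    exact (h s.a s.b s.c s.hab s.hac s.hbc).1.symm
  · rw [units_eq_neg_iff, ofPositive_eq_one_iff, ofPositive_eq_one_iff]
    exact (h s.a s.b s.c s.hab s.hac s.hbc).2.1
  · rw [mem_rootedTriangles_iff, (h x y z hxy hxz hyz).2.2 w hxw hyw hzw, units_eq_iff,
      units_eq_iff (ofPositive T ⟨x, y, z, hxy, hxz, hyz⟩) (ofPositive T ⟨x, w, z, _, _, _⟩),
      units_eq_iff (ofPositive T ⟨x, y, z, hxy, hxz, hyz⟩) (ofPositive T ⟨x, y, w, _, _, _⟩)]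
    simp only [ofPositive_eq_one_iff]

/-- An alternating relation contains one of any two oppositely oriented triples. It therefore cannot
be a proper part of the positive triples of an alternating `t`. -/
theorem eq_ofPositive {T : J → J → J → Prop} {R : J → J → J → J → Prop} (h : Consistent R T)
    (ht : IsAlternating t) (hle : ∀ x y z, T x y z → IsPositive t x y z) : t = ofPositive T := by
  funext q
  rw [units_eq_iff, ofPositive_eq_one_iff]
  refine ⟨fun h1 => ?_, fun h1 => (isPositive_iff q.hab q.hac q.hbc).1 (hle _ _ _ h1)⟩
  by_contra h2
  have h3 := hle _ _ _ (((h q.a q.b q.c q.hab q.hac q.hbc).2.1).2 h2)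
  rw [isPositive_iff q.hac q.hab q.hbc.symm, (ht q).2, h1] at h3
  exact absurd h3 (by decide)

theorem supportsClockwise_ofPositive {m : ℕ} {a : Fin m → J} {T : J → J → J → Prop}
    (h : IsAlternating (ofPositive T)) (hT : ∀ x y z, HullTriple a x y z → T x y z) :
    SupportsClockwise (ofPositive T) a := by
  have key : ∀ i j k : Fin m, i < j → j < k → ∀ (hij : a i ≠ a j) (hik : a i ≠ a k)
      (hjk : a j ≠ a k), ofPositive T ⟨a i, a j, a k, hij, hik, hjk⟩ = -1 := by
    intro i j k h1 h2 hij hik hjk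
    have h3 : ofPositive T ⟨a j, a i, a k, hij.symm, hjk, hik⟩ = 1 :=
      ofPositive_eq_one_iff.2 (hT _ _ _ ⟨i, j, k, h1, h2, rfl, rfl, rfl⟩)
    have h4 := (h ⟨a j, a i, a k, hij.symm, hjk, hik⟩).1
    have h5 := (h ⟨a i, a k, a j, hik, hij, hjk.symm⟩).2
    rw [h5, h4, h3]
  rintro i j k (⟨h1, h2⟩ | ⟨h1, h2⟩ | ⟨h1, h2⟩) hij hik hjk
  · exact key i j k h1 h2 hij hik hjk
  · rw [← key j k i h1 h2 hjk hij.symm hik.symm]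
    exact ((h ⟨a i, a j, a k, hij, hik, hjk⟩).1).symm
  · rw [← key k i j h1 h2 hik.symm hjk.symm hij]
    exact (h ⟨a k, a i, a j, hik.symm, hjk.symm, hij⟩).1

end

/-! ### The decision procedure -/

/-- `k` rounds of propagation, from the table in array `k + 2` to the table in array `2`. -/
def rounds : ℕ → Program
  | 0 => .const 7 0
  | k + 1 => .seq (fill (k + 2) (propagateFormula (k + 3))) (rounds k)

/-- A bound for the number of steps of `rounds`. -/
noncomputable def roundsCost : ℕ → Polynomial ℕ
  | 0 => 1
  | k + 1 => fillCost (propagateFormula (k + 3)) + roundsCost k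

/-- The decision procedure. -/
def decisionProgram : Program :=
  -- Each of the eleven rounds reads one array and writes the array before it, so a start in `13`
  -- ends in the output array `2`, and the input arrays `0` and `1` stay intact.
  .seq (fill 13 hullFormula) (.seq (rounds 11) (.seq ((checkFormula 2).compile 0)
    (.ite 2 (.const 0 1) (.const 0 0))))

section

variable {J : Type*} {n m : ℕ} (e : J ≃ Fin n)

open Classical in
/-- Array `A` holds the table of `T`. -/
def Represents (M : ℕ → ℕ → ℕ) (A : ℕ) (T : J → J → J → Prop) : Prop :=
  ∀ x y z, M A (((e x : ℕ) * n + e y) * n + e z) = if T x y z then 1 else 0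

/-- Array `1` holds the table of `R`. -/
def RepresentsRoots (M : ℕ → ℕ → ℕ) (R : J → J → J → J → Prop) : Prop :=
  ∀ x y z w, M 1 ((((e x : ℕ) * n + e y) * n + e z) * n + e w) ≠ 0 ↔ R x y z w

variable {e}

theorem Represents.ne_zero_iff {M : ℕ → ℕ → ℕ} {A : ℕ} {T : J → J → J → Prop}
    (h : Represents e M A T) (x y z : J) :
    M A (((e x : ℕ) * n + e y) * n + e z) ≠ 0 ↔ T x y z := by
  rw [h]; split_ifs with h' <;> simp [h']

variable (e) in
theorem exists_lt_iff {P : ℕ → Prop} : (∃ y < n, P y) ↔ ∃ w : J, P (e w) :=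
  ⟨fun ⟨y, hy, h⟩ => ⟨e.symm ⟨y, hy⟩, by simpa using h⟩, fun ⟨w, h⟩ => ⟨e w, (e w).2, h⟩⟩

variable (e) in
theorem forall_lt_iff {P : ℕ → Prop} : (∀ y < n, P y) ↔ ∀ w : J, P (e w) :=
  ⟨fun h w => h _ (e w).2, fun h y hy => by simpa using h (e.symm ⟨y, hy⟩)⟩

theorem coe_ne_coe_iff {x y : J} : (e x : ℕ) ≠ e y ↔ x ≠ y := by
  rw [Ne, Fin.val_inj, e.apply_eq_iff_eq]

theorem exists_coe_eq_iff {T : J → J → J → Prop} {x y z : J} :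
    (∃ a b c, (e a : ℕ) = e x ∧ (e b : ℕ) = e y ∧ (e c : ℕ) = e z ∧ T a b c) ↔ T x y z := by
  simp only [Fin.val_inj, e.apply_eq_iff_eq]
  exact ⟨fun ⟨_, _, _, rfl, rfl, rfl, h⟩ => h, fun h => ⟨_, _, _, rfl, rfl, rfl, h⟩⟩

theorem holds_propagateFormula {M : ℕ → ℕ → ℕ} {A : ℕ} {T : J → J → J → Prop}
    {R : J → J → J → J → Prop} (hT : Represents e M A T) (hR : RepresentsRoots e M R)
    (x y z : J) : (propagateFormula A).Holds n m M 3 (assign (e x) (e y) (e z)) ↔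
      propagate R T x y z := by
  simp only [propagateFormula, holds_or, holds_iff, Holds, exists_lt_iff e]
  simp [assign, ofDigitsFrom, Function.update_apply, -ne_eq, hT.ne_zero_iff, hR _ _ _ _,
    propagate, NonConvexQuad]

theorem holds_checkFormula {M : ℕ → ℕ → ℕ} {A : ℕ} {T : J → J → J → Prop}
    {R : J → J → J → J → Prop} (hT : Represents e M A T) (hR : RepresentsRoots e M R)
    (v : ℕ → ℕ) : (checkFormula A).Holds n m M 0 v ↔ Consistent R T := by
  simp only [checkFormula, holds_all, holds_imp, holds_iff, holds_ne, Holds, forall_lt_iff e]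
  simp [ofDigitsFrom, Function.update_apply, -ne_eq, coe_ne_coe_iff, hT.ne_zero_iff, hR _ _ _ _,
    Consistent]

theorem holds_hullFormula {M : ℕ → ℕ → ℕ} {a : Fin m → J} (ha : Function.Injective a)
    (hM : ∀ i, M 0 i = if h : i < m then (e (a ⟨i, h⟩) : ℕ) else 0) (x y z : J) :
    hullFormula.Holds n m M 3 (assign (e x) (e y) (e z)) ↔ HullTriple a x y z := by
  -- Quantifiers range over numbers below `n`, so the list positions must be among them.
  have hmn : m ≤ n := by
    simpa using Fintype.card_le_of_injective (e ∘ a) (e.injective.comp ha)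
  have hM' : ∀ i : Fin m, M 0 i = (e (a i) : ℕ) := fun i => by rw [hM, dif_pos i.2]
  simp only [hullFormula, Holds]
  simp only [Function.update_apply, assign]
  simp only [Nat.reduceEqDiff, if_true, if_false, OfNat.ofNat_ne_zero, OfNat.ofNat_ne_one,
    OfNat.zero_ne_ofNat, OfNat.one_ne_ofNat, one_ne_zero, Nat.reduceAdd, zero_ne_one]
  constructor
  · rintro ⟨i, -, j, -, k, -, hij, hjk, hk, h1, h2, h3⟩
    have hj := hjk.trans hk
    have hi := hij.trans hj
    refine ⟨⟨i, hi⟩, ⟨j, hj⟩, ⟨k, hk⟩, hij, hjk, ?_, ?_, ?_⟩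
    · exact e.injective (Fin.ext ((hM' ⟨j, hj⟩).symm.trans h1))
    · exact e.injective (Fin.ext ((hM' ⟨i, hi⟩).symm.trans h2))
    · exact e.injective (Fin.ext ((hM' ⟨k, hk⟩).symm.trans h3))
  · rintro ⟨i, j, k, hij, hjk, rfl, rfl, rfl⟩
    exact ⟨i, i.2.trans_le hmn, j, j.2.trans_le hmn, k, k.2.trans_le hmn, hij, hjk, k.2,
      hM' j, hM' i, hM' k⟩

theorem runs_fill_represents {B : ℕ} {φ : Formula} (hφ : φ.WellScoped 3) {T : J → J → J → Prop}
    {s : State} (h : ∀ M : ℕ → ℕ → ℕ, (∀ A, A ≠ B → M A = s.M A) → ∀ x y z : J,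
      (φ.Holds n m M 3 (assign (e x) (e y) (e z)) ↔ T x y z))
    (h0 : s.r 0 = n) (h1 : s.r 1 = m) :
    Runs (fill B φ) s ((fillCost φ).eval n) fun s' =>
      s'.r 0 = n ∧ s'.r 1 = m ∧ (∀ A, A ≠ B → s'.M A = s.M A) ∧ Represents e s'.M B T := by
  refine (runs_fill hφ (M₀ := s.M) (ψ := fun x y z => ∃ a b c : J,
    (e a : ℕ) = x ∧ (e b : ℕ) = y ∧ (e c : ℕ) = z ∧ T a b c) ?_ h0 h1 fun _ _ => rfl).mono le_rfl ?_
  · intro M hM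
    rw [forall_lt_iff e]; intro x
    rw [forall_lt_iff e]; intro y
    rw [forall_lt_iff e]; intro z
    exact (h M hM x y z).trans exists_coe_eq_iff.symm
  · rintro s' ⟨g0, g1, g2, g3⟩
    refine ⟨g0, g1, g2, fun x y z => ?_⟩
    rw [g3 _ (e x).2 _ (e y).2 _ (e z).2]
    by_cases h : T x y z
    · rw [if_pos h, if_pos (exists_coe_eq_iff.2 h)]
    · rw [if_neg h, if_neg (mt exists_coe_eq_iff.1 h)]

theorem runs_rounds {R : J → J → J → J → Prop} (k : ℕ) : ∀ (T : J → J → J → Prop) (s : State),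
    s.r 0 = n → s.r 1 = m → RepresentsRoots e s.M R → Represents e s.M (k + 2) T →
    Runs (rounds k) s ((roundsCost k).eval n) fun s' =>
      s'.r 0 = n ∧ s'.r 1 = m ∧ RepresentsRoots e s'.M R ∧
        Represents e s'.M 2 ((propagate R)^[k] T) := by
  induction k with
  | zero =>
    intro T s h0 h1 hR hT
    refine Runs.mono (Runs.const ⟨?_, ?_, hR, hT⟩) (by simp [roundsCost]) (fun _ h => h)
    · rw [State.setReg_r_of_ne _ _ (by norm_num), h0]
    · rw [State.setReg_r_of_ne _ _ (by norm_num), h1]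
  | succ k ih =>
    intro T s h0 h1 hR hT
    have hR' : ∀ M : ℕ → ℕ → ℕ, (∀ A, A ≠ k + 2 → M A = s.M A) → RepresentsRoots e M R :=
      fun M hM x y z w => by rw [hM 1 (by omega)]; exact hR x y z w
    have hfill := runs_fill_represents (B := k + 2) (wellScoped_propagateFormula (k + 3))
      (fun M hM => holds_propagateFormula (m := m) (M := M) (A := k + 3) (T := T)
        (fun x y z => by rw [hM (k + 3) (by omega)]; exact hT x y z) (hR' M hM)) h0 h1
    refine (hfill.seq (T' := (roundsCost k).eval n) fun s' hs' => ?_).mono (by simp [roundsCost]) fun _ h => h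
    exact ih _ s' hs'.1 hs'.2.1 (hR' _ hs'.2.2.1) hs'.2.2.2

/-- A bound for the number of steps of the decision procedure. -/
noncomputable def decisionCost : Polynomial ℕ :=
  fillCost hullFormula + (roundsCost 11 + ((checkFormula 2).cost + 2))

theorem representsRoots_inputState (cl : ClosureOperator (Set J)) (a : Fin m → J) :
    RepresentsRoots e (inputState cl a e).M (Surrounds cl) := by
  intro x y z w
  simp only [inputState, one_ne_zero, if_false, if_true]
  rw [← mem_rootedTriangles_iff]
  constructor
  · intro h
    obtain ⟨x', y', z', w', hi, h⟩ : ∃ _ _ _ _, _ := by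
      by_contra hcon
      exact h (if_neg hcon)
    obtain ⟨hi, hw⟩ := mul_add_inj (e w).2 (e w').2 hi
    obtain ⟨hi, hz⟩ := mul_add_inj (e z).2 (e z').2 hi
    obtain ⟨hx, hy⟩ := mul_add_inj (e y).2 (e y').2 hi
    rw [e.injective (Fin.ext hx), e.injective (Fin.ext hy), e.injective (Fin.ext hz),
      e.injective (Fin.ext hw)]
    exact h
  · intro h
    rw [if_pos ⟨x, y, z, w, rfl, h⟩]
    exact one_ne_zero

theorem runs_decisionProgram (cl : ClosureOperator (Set J)) {a : Fin m → J} (ha : Function.Injective a) :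
    Runs decisionProgram (inputState cl a e) (decisionCost.eval n) fun s =>
      let T := (propagate (Surrounds cl))^[11] (HullTriple a)
      Represents e s.M 2 T ∧ (Consistent (Surrounds cl) T → s.r 0 = 1) ∧
        (¬Consistent (Surrounds cl) T → s.r 0 = 0) := by
  have hR := representsRoots_inputState (e := e) cl a
  have hfill := runs_fill_represents (B := 13) (e := e) (m := m) (s := inputState cl a e)
    wellScoped_hullFormula
    (fun M hM => holds_hullFormula (M := M) ha (fun i => by
      rw [hM 0 (by norm_num)]; simp [inputState])) rfl rfl
  refine Runs.mono (hfill.seq (T' := (roundsCost 11).eval n +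
    ((checkFormula 2).cost.eval n + (1 + 1))) fun s₁ ⟨h0, h1, hM, hT⟩ => ?_)
    (by simp [decisionCost]) (fun _ h => h)
  refine (runs_rounds (R := Surrounds cl) 11 _ s₁ h0 h1
    (fun x y z w => by rw [hM 1 (by norm_num)]; exact hR x y z w) hT).seq ?_
  rintro s₂ ⟨h0, h1, hR, hT⟩
  have hcheck := runs_compile (checkFormula 2) 0 s₂ (fun _ => 0) (by simp)
    (wellScoped_checkFormula 2)
  rw [h0, holds_checkFormula hT hR] at hcheck
  refine hcheck.seq ?_
  rintro s₃ ⟨hf, h2⟩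
  rw [← hf.1] at hT
  refine Runs.ite (fun h => Runs.const ⟨hT, fun _ => State.setReg_r_self _ _ _, fun h' => ?_⟩)
    (fun h => Runs.const ⟨hT, fun h' => ?_, fun _ => State.setReg_r_self _ _ _⟩)
  · exact absurd (h2.1 h) h'
  · exact absurd h (h2.2 h')

end

end ConvexGeom

/-! ### Correctness of the decision procedure. -/

theorem mainTheorem1 :
    ∃ (P : RAM.Program) (p : Polynomial ℕ),
      ∀ (J : Type u) [Fintype J] (cl : ClosureOperator (Set J)),
        ConvexGeom.IsConvexFourGeometry cl →
        ∀ (m : ℕ) (a : Fin m → J), ConvexGeom.IsCircularListing cl a →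
          ((∀ e : J ≃ Fin (Fintype.card J), ∃ (k : ℕ) (s : RAM.State),
                k ≤ p.eval (Fintype.card J) ∧
                RAM.Exec P (ConvexGeom.inputState cl a e) k s ∧ ConvexGeom.Rejects s) ∧
              ¬ ∃ f : J → ConvexGeom.Plane, ConvexGeom.IsRealizationWithOrder cl a f) ∨
          (∃ t : ConvexGeom.Triple J → ℤˣ,
            (∀ e : J ≃ Fin (Fintype.card J), ∃ (k : ℕ) (s : RAM.State),
                k ≤ p.eval (Fintype.card J) ∧
                RAM.Exec P (ConvexGeom.inputState cl a e) k s ∧ ConvexGeom.Outputs e s t) ∧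
              (ConvexGeom.IsAssociated cl t ∧ ConvexGeom.SupportsClockwise t a) ∧
              (∀ t' : ConvexGeom.Triple J → ℤˣ,
                ConvexGeom.IsAssociated cl t' → ConvexGeom.SupportsClockwise t' a → t' = t) ∧
              (∀ f : J → ConvexGeom.Plane, ConvexGeom.IsRealizationWithOrder cl a f →
                ConvexGeom.WeaklyEquivalent (ConvexGeom.orderType f) t)) := by
  open ConvexGeom in
  refine ⟨decisionProgram, decisionCost, fun J _ cl _ m a ha => ?_⟩
  -- `T` is built without a numbering of `J`, so the verdict and the output are the same for every
  -- `e`.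
  let T := (propagate (Surrounds cl))^[11] (HullTriple a)
  have hruns := fun e : J ≃ Fin (Fintype.card J) => runs_decisionProgram (e := e) cl ha.1
  by_cases hT : Consistent (Surrounds cl) T
  · right
    have hle : ∀ x y z, HullTriple a x y z → T x y z := fun x y z h => by
      have : ∀ k, (propagate (Surrounds cl))^[k] (HullTriple a) x y z := fun k => by
        induction k with
        | zero => exact h
        | succ k ih => rw [Function.iterate_succ_apply']; exact .inl ih
      exact this 11
    have hunique : ∀ t' : Triple J → ℤˣ, IsAssociated cl t' → SupportsClockwise t' a →
        t' = ofPositive T := fun t' h h' =>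
      eq_ofPositive hT h.1 (h.isOrientation.iterate_propagate_le
        (fun _ _ _ _ ⟨_, _, _, h4, h5, h6, _⟩ => ⟨h4, h5, h6⟩)
        (h'.isPositive_of_hullTriple ha.1 h) 11)
    refine ⟨ofPositive T, fun e => ?_, ⟨hT.isAssociated,
      supportsClockwise_ofPositive hT.isAssociated.1 hle⟩, hunique, fun f hf => .inl ⟨1, ?_⟩⟩
    · obtain ⟨k, s, hk, he, hrep, h1, -⟩ := hruns e
      refine ⟨k, s, hk, he, h1 hT, fun q => ?_⟩
      rw [hrep]
      by_cases h : T q.a q.b q.c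
      · rw [if_pos h, if_pos (ofPositive_eq_one_iff.2 h)]
      · rw [if_neg h, if_neg (mt ofPositive_eq_one_iff.1 h)]
    -- The order type is itself associated and supports the order, so uniqueness gives equality and
    -- the identity permutation serves.
    · intro q
      rw [hunique _ hf.1.isAssociated hf.2]
      rfl
  · left
    refine ⟨fun e => ?_, ?_⟩
    · obtain ⟨k, s, hk, he, -, -, h0⟩ := hruns e
      exact ⟨k, s, hk, he, h0 hT⟩
    · rintro ⟨f, hf⟩
      exact hT (hf.1.isAssociated.isOrientation.consistent fun _ _ _ => hf.propagate_iff ha)
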